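/- For $v=(v_1,v_2)\in\mathbb Z^2$ let $V_v(x)=|x-v_1|+v_2$, and let $o=(0,0)$. Let $\mathcal Y_o$ be the (countable, discrete) set of functions $\xi:\mathbb Z\to\mathbb Z$ with $|\xi(x)-\xi(x+1)|=1$ for all $x$ and $\xi(x)=V_o(x)=|x|$ for all but finitely many $x$, ordered pointwise. For $\xi\in\mathcal Y_o$ put $\Delta_x\xi(y)=(\xi(x+1)+\xi(x-1)-2\xi(x))\mathbf 1\{y=x\}$ and $\theta_v\xi(x)=\xi(x+v_1)-v_2$. For $J>0$ the interface process seen from the vertex, $(\tilde\xi_t)_{t\ge0}$, is the Markov process on $\mathcal Y_o$ with generator $$\tilde{\mathcal L}^Jf(\xi)=\tfrac12\sum_{x\in\mathbb Z}\big[f(\xi+\Delta_x\xi)-f(\xi)\big]+J\big[f(\max\{\theta_{(-1,1)}\xi,V_o\})-f(\xi)\big]+J\big[f(\max\{\theta_{(1,1)}\xi,V_o\})-f(\xi)\big],$$ that is, its transition semigroup $(P_t)_{t\ge0}$ is a semigroup of Markov kernels on $\mathcal Y_o$ with $P_0=\mathrm{Id}$ and $\frac{d}{dt}P_tf(\xi)=\tilde{\mathcal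 L}^J(P_tf)(\xi)$ for all bounded $f:\mathcal Y_o\to\mathbb R$, all $\xi\in\mathcal Y_o$ and all $t\ge 0$. For probability measures $\mu,\nu$ on $\mathcal Y_o$ write $\mu\le\nu$ (stochastic domination) if $\int f\,d\mu\le\int f\,d\nu$ for every nondecreasing $f:\mathcal Y_o\to\mathbb R$ integrable with respect to both. Then for every $J>0$ there is exactly one such semigroup, it has exactly one invariant probability measure $\tilde\mu^J$, and the following holds. 1. The process is attractive: if two initial laws satisfy $\nu_1\le\nu_2$, then the laws of $\tilde\xi_t$ started from $\nu_1$ and from $\nu_2$ satisfy $\nu_1P_t\le\nu_2P_t$ for all $t\ge0$. 2. If $\tilde\xi_0=V_o$, then the law of $\tilde\xi_t$ is stochastically nondecreasing in $t$, is stochastically dominated by $\tilde\mu^J$ for every $t\ge 0$, and converges to $\tilde\mu^J$ as $t\to\infty$. 3. If $J\ge J'>0$, then $\tilde\mu^J\le\tilde\mu^{J'}$. -/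

import Mathlib

open MeasureTheory ProbabilityTheory Filter Topology
open scoped NNReal ENNReal

namespace FreeBoundary

/-- The cone `V_v(x) = |x - v₁| + v₂` with vertex `v`. -/
def cone (v : ℤ × ℤ) (x : ℤ) : ℤ := |x - v.1| + v.2

/-- The space `𝒴_o` of interfaces whose vertex is the origin `o = (0, 0)`: functions `ℤ → ℤ` with
unit increments which coincide with the cone `V_o` at all but finitely many sites. -/
@[ext]
structure Interface where
  toFun : ℤ → ℤ
  step : ∀ x, |toFun x - toFun (x + 1)| = 1
  finite_ne : {x | toFun x ≠ cone (0, 0) x}.Finite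

namespace Interface

/-- The pointwise order on interfaces. -/
noncomputable instance : PartialOrder Interface :=
  PartialOrder.lift toFun fun _ _ h => Interface.ext h

/-- `𝒴_o` is a countable state space; it carries the discrete topology and `σ`-algebra. -/
instance : TopologicalSpace Interface := ⊥

instance : DiscreteTopology Interface := ⟨rfl⟩

instance : MeasurableSpace Interface := ⊤

instance : DiscreteMeasurableSpace Interface := ⟨fun _ => trivial⟩

theorem le_def (ξ ξ' : Interface) : ξ ≤ ξ' ↔ ∀ x, ξ.toFun x ≤ ξ'.toFun x := Iff.rfl

theorem cone_zero (x : ℤ) : cone (0, 0) x = |x| := by simp [cone]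

/-- The value of an interface at `x` has the parity of `x`. -/
theorem parity (ξ : Interface) (x : ℤ) : (ξ.toFun x - x) % 2 = 0 := by
  obtain ⟨N, hN⟩ : ∃ N, ξ.toFun N = cone (0, 0) N := by
    by_contra! h
    exact Set.infinite_univ (ξ.finite_ne.subset fun x _ => h x)
  rw [cone_zero] at hN
  induction x using Int.inductionOn' (b := N) with
  | zero => rw [hN]; grind
  | succ k _ ih => have := ξ.step k; grind
  | pred k _ ih =>
    have := ξ.step (k - 1)
    rw [sub_add_cancel] at this
    grind

/-- The cone `V_o` as an interface. -/
def coneO : Interface where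
  toFun := cone (0, 0)
  step x := by rw [cone_zero, cone_zero]; grind
  finite_ne := by simp

/-- The interface `ξ + Δ_x ξ`, where
`Δ_x ξ(y) = (ξ(x + 1) + ξ(x - 1) - 2 ξ(x)) 1{y = x}`. -/
def flip (ξ : Interface) (x : ℤ) : Interface where
  toFun y := ξ.toFun y +
    if y = x then ξ.toFun (x + 1) + ξ.toFun (x - 1) - 2 * ξ.toFun x else 0
  step y := by
    have h1 := ξ.step y
    have h2 := ξ.step x
    have h3 := ξ.step (x - 1)
    rw [sub_add_cancel] at h3
    by_cases hy : y = x
    · subst hy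
      have : y + 1 ≠ y := by omega
      simp only [if_true, this, if_false]
      grind
    · by_cases hy' : y + 1 = x
      · subst hy'
        simp only [hy, if_true, if_false, add_sub_cancel_right]
        grind
      · simpa [hy, hy'] using h1
  finite_ne := by
    refine (ξ.finite_ne.union (Set.finite_singleton x)).subset fun y hy => ?_
    by_cases h : y = x
    · exact Or.inr h
    · left
      simpa [h] using hy

/-- The function `θ_v f(x) = f(x + v₁) - v₂`, that is, `f` as seen from `v`. -/
def theta (v : ℤ × ℤ) (f : ℤ → ℤ) (x : ℤ) : ℤ := f (x + v.1) - v.2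

/-- The interface `max {θ_{(a,1)} ξ, V_o}`, for `a = ± 1`. -/
def kill (a : ℤ) (ha : |a| = 1) (ξ : Interface) : Interface where
  toFun x := max (theta (a, 1) ξ.toFun x) (cone (0, 0) x)
  step x := by
    have h1 := ξ.step (x + a)
    have h2 := ξ.parity (x + a)
    have h3 : x + 1 + a = x + a + 1 := by ring
    simp only [theta, cone_zero, h3]
    grind
  finite_ne := by
    refine (ξ.finite_ne.preimage (f := fun x => x + a)
      (add_left_injective a).injOn).subset fun x hx => ?_
    simp only [Set.mem_preimage, Set.mem_ofPred_eq] at hx ⊢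
    intro h
    apply hx
    simp only [theta, cone_zero] at h ⊢
    rw [h]
    grind

end Interface

/-- The generator
`L f(ξ) = ½ ∑_x [f(ξ + Δ_x ξ) - f(ξ)] + J [f(max {θ_{(-1,1)} ξ, V_o}) - f(ξ)]
  + J [f(max {θ_{(1,1)} ξ, V_o}) - f(ξ)]`
of the interface process as seen from the vertex. All but finitely many terms of the sum vanish. -/
noncomputable def generator (J : ℝ) (f : Interface → ℝ) (ξ : Interface) : ℝ :=
  1 / 2 * ∑' x : ℤ, (f (ξ.flip x) - f ξ)
    + J * (f (ξ.kill (-1) (by norm_num)) - f ξ)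
    + J * (f (ξ.kill 1 (by norm_num)) - f ξ)

/-- `P` is the transition semigroup of a Markov process on `𝒴_o` with generator `generator J`:
a semigroup of Markov kernels which satisfies the Kolmogorov equation
`d/dt P_t f = L P_t f` for every bounded `f`. -/
structure IsInterfaceSemigroup (J : ℝ) (P : ℝ≥0 → Kernel Interface Interface) : Prop where
  markov : ∀ t, IsMarkovKernel (P t)
  zero : P 0 = Kernel.id
  add : ∀ s t, P (s + t) = (P t).comp (P s)
  kolmogorov : ∀ f : Interface → ℝ, (∃ C, ∀ ξ, |f ξ| ≤ C) → ∀ (ξ : Interface) (t : ℝ≥0),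
    HasDerivWithinAt (fun s : ℝ => ∫ η, f η ∂(P s.toNNReal ξ))
      (generator J (fun ζ => ∫ η, f η ∂(P t ζ)) ξ) (Set.Ici 0) t

/-- The law at time `t` of the process with transition semigroup `P` and initial law `ν`. -/
noncomputable def lawAt {J : ℝ} {P : ℝ≥0 → Kernel Interface Interface}
    (hP : IsInterfaceSemigroup J P) (ν : ProbabilityMeasure Interface) (t : ℝ≥0) :
    ProbabilityMeasure Interface :=
  ⟨(ν : Measure Interface).bind (P t), by
    have := hP.markov t
    infer_instance⟩

/-- The initial law of the process started from the cone `V_o`. -/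
noncomputable def startCone : ProbabilityMeasure Interface :=
  ⟨Measure.dirac Interface.coneO, inferInstance⟩

/-- `μ` is an invariant probability measure of the process with transition semigroup `P`. -/
def IsInvariantLaw (P : ℝ≥0 → Kernel Interface Interface) (μ : ProbabilityMeasure Interface) :
    Prop :=
  ∀ t, Kernel.Invariant (P t) (μ : Measure Interface)

/-- Stochastic domination: `∫ f dμ ≤ ∫ f dν` for all nondecreasing `f : 𝒴_o → ℝ` for which both
expectations exist. -/
def StochLE (μ ν : ProbabilityMeasure Interface) : Prop :=
  ∀ f : Interface → ℝ, Monotone f → Integrable f (μ : Measure Interface) →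
    Integrable f (ν : Measure Interface) →
    ∫ ξ, f ξ ∂(μ : Measure Interface) ≤ ∫ ξ, f ξ ∂(ν : Measure Interface)

/-- Attractivity: stochastic domination between initial laws persists at all times. -/
def Attractive {J : ℝ} {P : ℝ≥0 → Kernel Interface Interface}
    (hP : IsInterfaceSemigroup J P) : Prop :=
  ∀ ν₁ ν₂ : ProbabilityMeasure Interface, StochLE ν₁ ν₂ →
    ∀ t, StochLE (lawAt hP ν₁ t) (lawAt hP ν₂ t)

end FreeBoundary

open FreeBoundary

/-! The process is a jump process with finitely many active moves in each state but unbounded total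
rate, so everything rests on a Lyapunov function: the area between the interface and the cone. Flips
change the area by discrete Laplacians, whose sum telescopes to 2. The two kill moves together
remove at least twice the size of the support. Hence `jumpGen_area_le`: the drift of the area is at
most `1 - 2 * J * |supp|`. Area has finite sublevel sets, so the maximum principle
`nonpos_of_subsolution` holds for locally bounded solutions of the backward equation. It gives
uniqueness, existence by truncating the moves (`exists_isSolution`), and the tightness that turns
solutions into Markov kernels (`exists_semigroup`).

A flip is not monotone, but it splits into a raising and a lowering heat bath update, and these are;
so are the kill moves. The same maximum principle on ordered pairs yields attractivity
(`IsSolution.monotone`). Since kill moves only lower the interface, a larger `J` gives a smaller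
solution for monotone data (`le_of_rates_le`).

The cone is the minimal state, so the law started there increases in time. Integrating the drift
inequality and using this monotonicity bounds the mean support size by `1 / J` uniformly in time
(`integral_truncCard_le`), hence the laws are tight. Probabilities of upper sets increase and
determine point masses, so the laws converge, and the limit is invariant. From every state the kill
moves reach the cone with positive probability, which leaves room for only one invariant law
(`invariant_unique`). The remaining comparisons with invariant laws follow from minimality of the
cone or by letting time tend to infinity. -/

namespace FreeBoundary

/-! ### Jump generators, Lyapunov functions and the maximum principle. -/

section JumpProcess

variable {S ι : Type*}

/-- The generator `f ↦ ∑ i, r i (f (φ i ξ) - f ξ)` of the jump process which performs the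
move `φ i` at rate `r i`. -/
noncomputable def jumpGen (φ : ι → S → S) (r : ι → ℝ) (f : S → ℝ) (ξ : S) : ℝ :=
  ∑' i, r i * (f (φ i ξ) - f ξ)

/-- `V` is a Lyapunov function with drift at most `c` for the moves `φ` with rates `r`. -/
structure IsLyapunov (φ : ι → S → S) (r : ι → ℝ) (V : S → ℝ) (c : ℝ) : Prop where
  rate_nonneg : ∀ i, 0 ≤ r i
  finite_moves : ∀ ξ, {i | φ i ξ ≠ ξ}.Finite
  nonneg : ∀ ξ, 0 ≤ V ξ
  finite_sublevel : ∀ a, {ξ | V ξ ≤ a}.Finite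
  const_nonneg : 0 ≤ c
  drift : ∀ ξ, jumpGen φ r V ξ ≤ c

theorem jumpGen_eq_sum (φ : ι → S → S) (r : ι → ℝ) (f : S → ℝ) {ξ : S} {s : Finset ι}
    (hs : ∀ i, φ i ξ ≠ ξ → i ∈ s) :
    jumpGen φ r f ξ = ∑ i ∈ s, r i * (f (φ i ξ) - f ξ) :=
  tsum_eq_sum fun i hi => by
    have : φ i ξ = ξ := by
      by_contra h
      exact hi (hs i h)
    simp [this]

/-- Boundedness of real functions. -/
def Bdd (f : S → ℝ) : Prop := ∃ C, ∀ ξ, |f ξ| ≤ C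

theorem Bdd.add {f g : S → ℝ} (hf : Bdd f) (hg : Bdd g) : Bdd (f + g) := by
  obtain ⟨C, hC⟩ := hf
  obtain ⟨D, hD⟩ := hg
  exact ⟨C + D, fun ξ => (abs_add_le _ _).trans (add_le_add (hC ξ) (hD ξ))⟩

theorem Bdd.smul {f : S → ℝ} (a : ℝ) (hf : Bdd f) : Bdd (a • f) := by
  obtain ⟨C, hC⟩ := hf
  exact ⟨|a| * C, fun ξ => by
    simpa [abs_mul] using mul_le_mul_of_nonneg_left (hC ξ) (abs_nonneg a)⟩

theorem Bdd.sub {f g : S → ℝ} (hf : Bdd f) (hg : Bdd g) : Bdd (f - g) := by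
  simpa [sub_eq_add_neg] using hf.add (hg.smul (-1))

theorem Bdd.of_nonneg_of_le {f : S → ℝ} {C : ℝ} (h0 : ∀ ξ, 0 ≤ f ξ) (h : ∀ ξ, f ξ ≤ C) : Bdd f :=
  ⟨C, fun ξ => abs_le.2 ⟨by linarith [h0 ξ, h ξ], h ξ⟩⟩

theorem bdd_const (a : ℝ) : Bdd (fun _ : S => a) := ⟨|a|, fun _ => le_rfl⟩

theorem Bdd.mul {f g : S → ℝ} (hf : Bdd f) (hg : Bdd g) : Bdd (f * g) := by
  obtain ⟨C, hC⟩ := hf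
  obtain ⟨D, hD⟩ := hg
  exact ⟨C * D, fun ξ => by
    simpa [abs_mul] using mul_le_mul (hC ξ) (hD ξ) (abs_nonneg _) ((abs_nonneg _).trans (hC ξ))⟩

theorem bdd_indicator (A : Set S) : Bdd (A.indicator fun _ => (1 : ℝ)) :=
  Bdd.of_nonneg_of_le (C := 1) (fun ξ => Set.indicator_nonneg (fun _ _ => zero_le_one) ξ)
    fun ξ => Set.indicator_le_self' (fun _ _ => zero_le_one) ξ

/-- Only difference quotients from the left enter, so the maximum may sit at the end of the time
interval. -/
theorem deriv_nonneg_of_max_right {f : ℝ → ℝ} {f' t : ℝ} (ht : 0 < t)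
    (hd : HasDerivWithinAt f f' (Set.Ici 0) t) (hmax : ∀ s ∈ Set.Icc 0 t, f s ≤ f t) :
    0 ≤ f' := by
  have hd' : HasDerivWithinAt f f' (Set.Icc 0 t) t := hd.mono Set.Icc_subset_Ici_self
  have h := IsLocalMaxOn.hasFDerivWithinAt_nonpos (a := t) (y := 0 - t)
    (s := Set.Icc 0 t) (f := f) ?_ hd'.hasFDerivWithinAt ?_
  · simp only [zero_sub, ContinuousLinearMap.map_neg] at h
    have h' : 0 ≤ t * f' := by simpa using h
    exact nonneg_of_mul_nonneg_right h' ht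
  · filter_upwards [self_mem_nhdsWithin] with s hs using hmax s hs
  · refine sub_mem_posTangentConeAt_of_segment_subset ?_
    rw [segment_symm, segment_eq_Icc ht.le]

variable {φ : ι → S → S} {r : ι → ℝ} {V : S → ℝ} {c : ℝ}

namespace IsLyapunov

theorem moves_mem (h : IsLyapunov φ r V c) (ξ : S) (i : ι) (hi : φ i ξ ≠ ξ) :
    i ∈ (h.finite_moves ξ).toFinset := by
  simpa using hi

theorem jumpGen_eq (h : IsLyapunov φ r V c) (f : S → ℝ) (ξ : S) :
    jumpGen φ r f ξ = ∑ i ∈ (h.finite_moves ξ).toFinset, r i * (f (φ i ξ) - f ξ) :=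
  jumpGen_eq_sum φ r f (h.moves_mem ξ)

theorem jumpGen_add (h : IsLyapunov φ r V c) (f g : S → ℝ) (ξ : S) :
    jumpGen φ r (fun η => f η + g η) ξ = jumpGen φ r f ξ + jumpGen φ r g ξ := by
  simp only [h.jumpGen_eq, ← Finset.sum_add_distrib]
  exact Finset.sum_congr rfl fun _ _ => by ring

theorem jumpGen_sub (h : IsLyapunov φ r V c) (f g : S → ℝ) (ξ : S) :
    jumpGen φ r (fun η => f η - g η) ξ = jumpGen φ r f ξ - jumpGen φ r g ξ := by
  simp only [h.jumpGen_eq, ← Finset.sum_sub_distrib]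
  exact Finset.sum_congr rfl fun _ _ => by ring

theorem jumpGen_mul (h : IsLyapunov φ r V c) (a : ℝ) (f : S → ℝ) (ξ : S) :
    jumpGen φ r (fun η => a * f η) ξ = a * jumpGen φ r f ξ := by
  simp only [h.jumpGen_eq, Finset.mul_sum]
  exact Finset.sum_congr rfl fun _ _ => by ring

theorem jumpGen_add_const (h : IsLyapunov φ r V c) (f : S → ℝ) (a : ℝ) (ξ : S) :
    jumpGen φ r (fun η => f η + a) ξ = jumpGen φ r f ξ := by
  simp only [h.jumpGen_eq, add_sub_add_right_eq_sub]

/-- Maximum principle: a subsolution of `u' = L u` which is locally bounded above and starts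
nonpositive stays nonpositive. The inequality is only needed where `u` is positive. -/
theorem nonpos_of_subsolution (h : IsLyapunov φ r V c) {u u' : ℝ → S → ℝ}
    (hC : ∀ T, ∃ C, ∀ t ∈ Set.Icc 0 T, ∀ ξ, u t ξ ≤ C) (h0 : ∀ ξ, u 0 ξ ≤ 0)
    (hd : ∀ t, 0 ≤ t → ∀ ξ, HasDerivWithinAt (fun s => u s ξ) (u' t ξ) (Set.Ici 0) t)
    (hu' : ∀ t, 0 ≤ t → ∀ ξ, 0 < u t ξ → u' t ξ ≤ jumpGen φ r (u t) ξ)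
    {T : ℝ} (hT : 0 ≤ T) (ξ₀ : S) : u T ξ₀ ≤ 0 := by
  have key : ∀ ε, 0 < ε → u T ξ₀ - ε * (1 + V ξ₀ + (c + 1) * T) ≤ 0 := by
    intro ε hε
    by_contra! hpos
    -- The penalty `ε * V` confines positive values of `v` to the finite set `{V ≤ C / ε}`. The
    -- slope `c + 1` exceeds the drift bound `c`, which makes the inequality at a maximum strictly
    -- contradictory.
    set v : ℝ → S → ℝ := fun t ξ => u t ξ - ε * (1 + V ξ + (c + 1) * t) with hv
    obtain ⟨C, hC⟩ := hC T
    have hc := h.const_nonneg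
    have hK := h.finite_sublevel (C / ε)
    have hout : ∀ t ∈ Set.Icc 0 T, ∀ ξ, C / ε < V ξ → v t ξ ≤ 0 := by
      intro t ht ξ hξ
      have h1 : C < ε * V ξ := by rwa [div_lt_iff₀' hε] at hξ
      have h2 : 0 ≤ ε * ((c + 1) * t) := by have := ht.1; positivity
      have := hC t ht ξ
      simp only [hv]
      nlinarith
    have hcont : ∀ ξ, ContinuousOn (fun t => v t ξ) (Set.Icc 0 T) := by
      intro ξ
      have : ContinuousOn (fun t => u t ξ) (Set.Icc 0 T) := fun t ht =>
        ((hd t ht.1 ξ).mono Set.Icc_subset_Ici_self).continuousWithinAt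
      exact this.sub (by fun_prop)
    have hξ₀ : V ξ₀ ≤ C / ε := by
      by_contra! hlt
      exact absurd (hout T ⟨hT, le_rfl⟩ ξ₀ hlt) (not_le.2 hpos)
    -- A best time for each state, then a best state among finitely many: this gives a global
    -- space-time maximum.
    choose m hm hmax using fun ξ =>
      isCompact_Icc.exists_isMaxOn (Set.nonempty_Icc.2 hT) (hcont ξ)
    obtain ⟨η, hη, hηmax⟩ := hK.exists_maximalFor (fun ξ => v (m ξ) ξ) _ ⟨ξ₀, hξ₀⟩
    have hle : ∀ t ∈ Set.Icc 0 T, ∀ ξ, V ξ ≤ C / ε → v t ξ ≤ v (m η) η := by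
      intro t ht ξ hξ
      refine (hmax ξ ht).trans ?_
      rcases le_total (v (m ξ) ξ) (v (m η) η) with h | h
      · exact h
      · exact hηmax hξ h
    have hvpos : 0 < v (m η) η := hpos.trans_le (hle T ⟨hT, le_rfl⟩ ξ₀ hξ₀)
    have hle' : ∀ ξ, v (m η) ξ ≤ v (m η) η := by
      intro ξ
      rcases le_or_gt (V ξ) (C / ε) with h | h
      · exact hle _ (hm η) ξ h
      · exact (hout _ (hm η) ξ h).trans hvpos.le
    have hmpos : 0 < m η := by
      refine lt_of_le_of_ne (hm η).1 fun h00 => ?_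
      rw [← h00] at hvpos
      have := h0 η
      have := h.nonneg η
      simp only [hv] at hvpos
      nlinarith
    have hupos : 0 < u (m η) η := by
      have : 0 ≤ ε * (1 + V η + (c + 1) * m η) := by
        have := h.nonneg η
        positivity
      simp only [hv] at hvpos
      linarith
    have hder : HasDerivWithinAt (fun s => v s η) (u' (m η) η - ε * (c + 1)) (Set.Ici 0) (m η) := by
      refine (hd _ hmpos.le η).sub ?_
      have := (((hasDerivAt_id (m η)).const_mul (c + 1)).const_add (1 + V η)).const_mul ε
      simpa using this.hasDerivWithinAt
    have h1 := deriv_nonneg_of_max_right hmpos hder fun s hs =>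
      hle s ⟨hs.1, hs.2.trans (hm η).2⟩ η hη
    have h2 := hu' _ hmpos.le η hupos
    have h3 : jumpGen φ r (v (m η)) η = jumpGen φ r (u (m η)) η - ε * jumpGen φ r V η := by
      rw [← h.jumpGen_mul, ← h.jumpGen_sub,
        ← h.jumpGen_add_const _ (ε * (1 + (c + 1) * m η))]
      congr 1
      ext ξ
      simp only [hv]
      ring
    have h4 : jumpGen φ r (v (m η)) η ≤ 0 := by
      rw [h.jumpGen_eq]
      exact Finset.sum_nonpos fun i _ =>
        mul_nonpos_of_nonneg_of_nonpos (h.rate_nonneg i) (sub_nonpos.2 (hle' _))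
    have h5 := mul_le_mul_of_nonneg_left (h.drift η) hε.le
    nlinarith
  have hlim : Tendsto (fun ε : ℝ => u T ξ₀ - ε * (1 + V ξ₀ + (c + 1) * T)) (𝓝[>] 0)
      (𝓝 (u T ξ₀ - 0 * (1 + V ξ₀ + (c + 1) * T))) :=
    ((continuous_const.sub (continuous_id.mul continuous_const)).tendsto 0).mono_left
      nhdsWithin_le_nhds
  rw [zero_mul, sub_zero] at hlim
  exact le_of_tendsto hlim (by filter_upwards [self_mem_nhdsWithin] with ε hε using key ε hε)

end IsLyapunov

end JumpProcess

/-! ### The backward equation: comparison, a priori bounds and truncation. -/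

section Solutions

variable {S ι : Type*} {φ : ι → S → S} {r : ι → ℝ} {V : S → ℝ} {c : ℝ}

/-- `u` is a locally bounded solution of the backward equation `u' = L u` with initial value
`f`. -/
structure IsSolution (φ : ι → S → S) (r : ι → ℝ) (f : S → ℝ) (u : ℝ → S → ℝ) : Prop where
  init : u 0 = f
  locally_bdd : ∀ T, ∃ C, ∀ t ∈ Set.Icc 0 T, ∀ ξ, |u t ξ| ≤ C
  deriv : ∀ t, 0 ≤ t → ∀ ξ,
    HasDerivWithinAt (fun s => u s ξ) (jumpGen φ r (u t) ξ) (Set.Ici 0) t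

theorem isSolution_const (a : ℝ) : IsSolution φ r (fun _ => a) fun _ _ => a where
  init := rfl
  locally_bdd _ := ⟨|a|, fun _ _ _ => le_rfl⟩
  deriv t _ ξ := by simpa [jumpGen] using hasDerivWithinAt_const t (Set.Ici 0) a

namespace IsSolution

theorem add (h : IsLyapunov φ r V c) {f g : S → ℝ} {u v : ℝ → S → ℝ} (hu : IsSolution φ r f u)
    (hv : IsSolution φ r g v) : IsSolution φ r (f + g) (u + v) where
  init := by rw [Pi.add_apply, hu.init, hv.init]
  locally_bdd T := by
    obtain ⟨C, hC⟩ := hu.locally_bdd T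
    obtain ⟨D, hD⟩ := hv.locally_bdd T
    exact ⟨C + D, fun t ht ξ => (abs_add_le _ _).trans (add_le_add (hC t ht ξ) (hD t ht ξ))⟩
  deriv t ht ξ := by
    have := (hu.deriv t ht ξ).add (hv.deriv t ht ξ)
    rw [← h.jumpGen_add] at this
    exact this

theorem smul (h : IsLyapunov φ r V c) (a : ℝ) {f : S → ℝ} {u : ℝ → S → ℝ}
    (hu : IsSolution φ r f u) : IsSolution φ r (a • f) (a • u) where
  init := by rw [Pi.smul_apply, hu.init]
  locally_bdd T := by
    obtain ⟨C, hC⟩ := hu.locally_bdd T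
    exact ⟨|a| * C, fun t ht ξ => by
      simpa [abs_mul] using mul_le_mul_of_nonneg_left (hC t ht ξ) (abs_nonneg a)⟩
  deriv t ht ξ := by
    have := (hu.deriv t ht ξ).const_mul a
    rw [← h.jumpGen_mul] at this
    exact this

theorem shift {f : S → ℝ} {u : ℝ → S → ℝ} (hu : IsSolution φ r f u) {s : ℝ} (hs : 0 ≤ s) :
    IsSolution φ r (u s) fun t => u (t + s) where
  init := by simp
  locally_bdd T := by
    obtain ⟨C, hC⟩ := hu.locally_bdd (T + s)
    exact ⟨C, fun t ht ξ => hC _ ⟨add_nonneg ht.1 hs, by linarith [ht.2]⟩ ξ⟩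
  deriv t ht ξ := by
    have h1 := hu.deriv (t + s) (add_nonneg ht hs) ξ
    have h2 : HasDerivWithinAt (fun x : ℝ => x + s) 1 (Set.Ici 0) t :=
      ((hasDerivAt_id t).add_const s).hasDerivWithinAt
    have := HasDerivWithinAt.scomp t h1 h2 fun x hx => add_nonneg hx hs
    rw [one_smul] at this
    exact this

theorem mono (h : IsLyapunov φ r V c) {f g : S → ℝ} {u v : ℝ → S → ℝ}
    (hu : IsSolution φ r f u) (hv : IsSolution φ r g v) (hfg : ∀ ξ, f ξ ≤ g ξ) {t : ℝ}
    (ht : 0 ≤ t) (ξ : S) : u t ξ ≤ v t ξ := by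
  refine sub_nonpos.1 (h.nonpos_of_subsolution (u := fun s η => u s η - v s η)
    (u' := fun s η => jumpGen φ r (u s) η - jumpGen φ r (v s) η) ?_ ?_ ?_ ?_ ht ξ)
  · intro T
    obtain ⟨C, hC⟩ := hu.locally_bdd T
    obtain ⟨D, hD⟩ := hv.locally_bdd T
    exact ⟨C + D, fun t ht ξ => by
      linarith [(abs_le.1 (hC t ht ξ)).2, (abs_le.1 (hD t ht ξ)).1]⟩
  · intro η
    simpa [hu.init, hv.init] using hfg η
  · exact fun s hs η => (hu.deriv s hs η).sub (hv.deriv s hs η)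
  · exact fun s _ η _ => (h.jumpGen_sub _ _ _).ge

theorem unique (h : IsLyapunov φ r V c) {f : S → ℝ} {u v : ℝ → S → ℝ}
    (hu : IsSolution φ r f u) (hv : IsSolution φ r f v) {t : ℝ} (ht : 0 ≤ t) (ξ : S) :
    u t ξ = v t ξ :=
  le_antisymm (hu.mono h hv (fun _ => le_rfl) ht ξ) (hv.mono h hu (fun _ => le_rfl) ht ξ)

theorem abs_le (h : IsLyapunov φ r V c) {f : S → ℝ} {u : ℝ → S → ℝ}
    (hu : IsSolution φ r f u) {C : ℝ} (hf : ∀ ξ, |f ξ| ≤ C) {t : ℝ} (ht : 0 ≤ t) (ξ : S) :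
    |u t ξ| ≤ C :=
  _root_.abs_le.2 ⟨(isSolution_const (-C)).mono h hu (fun ξ => (_root_.abs_le.1 (hf ξ)).1) ht ξ,
    hu.mono h (isSolution_const C) (fun ξ => (_root_.abs_le.1 (hf ξ)).2) ht ξ⟩

theorem continuousOn {f : S → ℝ} {u : ℝ → S → ℝ} (hu : IsSolution φ r f u) (ξ : S) :
    ContinuousOn (fun t => u t ξ) (Set.Ici 0) :=
  fun t ht => (hu.deriv t ht ξ).continuousWithinAt

/-- A solution started below `V / a` stays below `(V + c t) / a`. -/
theorem le_lyapunov (h : IsLyapunov φ r V c) {f : S → ℝ} {u : ℝ → S → ℝ}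
    (hu : IsSolution φ r f u) {a : ℝ} (ha : 0 < a) (hf : ∀ ξ, a * f ξ ≤ V ξ) {t : ℝ}
    (ht : 0 ≤ t) (ξ : S) : a * u t ξ ≤ V ξ + c * t := by
  refine sub_nonpos.1 (h.nonpos_of_subsolution (u := fun s η => a * u s η - (V η + c * s))
    (u' := fun s η => a * jumpGen φ r (u s) η - c * 1) ?_ ?_ ?_ ?_ ht ξ)
  · intro T
    obtain ⟨C, hC⟩ := hu.locally_bdd T
    refine ⟨a * C, fun t ht ξ => ?_⟩
    have h1 := mul_le_mul_of_nonneg_left (_root_.abs_le.1 (hC t ht ξ)).2 ha.le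
    have h2 := mul_nonneg h.const_nonneg ht.1
    have h3 := h.nonneg ξ
    linarith
  · intro η
    simpa [hu.init] using hf η
  · exact fun s hs η => ((hu.deriv s hs η).const_mul a).sub
      (((hasDerivAt_id s).const_mul c).const_add (V η)).hasDerivWithinAt
  · intro s hs η _
    have h1 : jumpGen φ r (fun ζ => a * u s ζ - (V ζ + c * s)) η =
        a * jumpGen φ r (u s) η - jumpGen φ r V η := by
      rw [h.jumpGen_sub, h.jumpGen_add_const, h.jumpGen_mul]
    have h2 := h.drift η
    rw [h1]
    linarith

end IsSolution

theorem IsLyapunov.abs_jumpGen_le (h : IsLyapunov φ r V c) {f : S → ℝ} {C : ℝ} (ξ : S)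
    (hf : |f ξ| ≤ C) (hf' : ∀ i ∈ (h.finite_moves ξ).toFinset, |f (φ i ξ)| ≤ C) :
    |jumpGen φ r f ξ| ≤ (∑ i ∈ (h.finite_moves ξ).toFinset, r i) * (2 * C) := by
  rw [h.jumpGen_eq, Finset.sum_mul]
  refine (Finset.abs_sum_le_sum_abs _ _).trans (Finset.sum_le_sum fun i hi => ?_)
  rw [abs_mul, abs_of_nonneg (h.rate_nonneg i)]
  refine mul_le_mul_of_nonneg_left ?_ (h.rate_nonneg i)
  have h1 := _root_.abs_le.1 hf
  have h2 := _root_.abs_le.1 (hf' i hi)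
  exact _root_.abs_le.2 ⟨by linarith [h1.2, h2.1], by linarith [h1.1, h2.2]⟩

theorem _root_.ContinuousLinearMap.exists_hasDerivAt_linear_ode {E : Type*}
    [NormedAddCommGroup E] [NormedSpace ℝ E] [CompleteSpace E] (A : E →L[ℝ] E) (x : E) :
    ∃ U : ℝ → E, U 0 = x ∧ ∀ t, HasDerivAt U (A (U t)) t := by
  refine ⟨fun t => NormedSpace.exp (t • A) x, by simp, fun t => ?_⟩
  have := hasDerivAt_exp_smul_const' A t
  exact (ContinuousLinearMap.apply ℝ E x).hasFDerivAt.comp_hasDerivAt t this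

/-- For bounded total jump rates the generator is a bounded operator, and its exponential solves
the backward equation. -/
theorem IsLyapunov.exists_isSolution_of_bdd_rates (h : IsLyapunov φ r V c) {B : ℝ}
    (hB : ∀ ξ, ∑ i ∈ (h.finite_moves ξ).toFinset, r i ≤ B) {f : S → ℝ} (hf : Bdd f) :
    ∃ u, IsSolution φ r f u := by
  -- With the discrete topology every bounded function is continuous, so the bounded functions
  -- become a Banach space on which the generator is bounded.
  let _ : TopologicalSpace S := ⊥
  have : DiscreteTopology S := ⟨rfl⟩
  have hbound : ∀ (g : BoundedContinuousFunction S ℝ) ξ, ‖jumpGen φ r g ξ‖ ≤ 2 * B * ‖g‖ := by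
    intro g ξ
    refine (h.abs_jumpGen_le ξ (g.norm_coe_le_norm ξ) fun i _ => g.norm_coe_le_norm _).trans ?_
    have := mul_le_mul_of_nonneg_right (hB ξ) (norm_nonneg g)
    linarith
  let A₀ : BoundedContinuousFunction S ℝ →ₗ[ℝ] BoundedContinuousFunction S ℝ :=
    { toFun := fun g => BoundedContinuousFunction.ofNormedAddCommGroupDiscrete (jumpGen φ r g) _
        (hbound g)
      map_add' := fun g g' => by
        ext ξ
        exact h.jumpGen_add g g' ξ
      map_smul' := fun a g => by
        ext ξ
        exact h.jumpGen_mul a g ξ }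
  let A := A₀.mkContinuous (max (2 * B) 0) fun g => by
    refine (BoundedContinuousFunction.norm_le (by positivity)).2 fun ξ => (hbound g ξ).trans ?_
    exact mul_le_mul_of_nonneg_right (le_max_left _ _) (norm_nonneg _)
  obtain ⟨C, hC⟩ := hf
  let F : BoundedContinuousFunction S ℝ :=
    BoundedContinuousFunction.ofNormedAddCommGroupDiscrete f C hC
  obtain ⟨U, hU0, hU⟩ := A.exists_hasDerivAt_linear_ode F
  refine ⟨fun t => U t, ?_, ?_, ?_⟩
  · ext ξ
    simp only [hU0]
    rfl
  · intro T
    have hc : ContinuousOn U (Set.Icc 0 T) := fun t _ => (hU t).continuousAt.continuousWithinAt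
    obtain ⟨D, hD⟩ := isCompact_Icc.exists_bound_of_continuousOn hc
    exact ⟨D, fun t ht ξ => ((U t).norm_coe_le_norm ξ).trans (hD t ht)⟩
  · intro t _ ξ
    exact ((BoundedContinuousFunction.evalCLM ℝ ξ).hasFDerivAt.comp_hasDerivAt t
      (hU t)).hasDerivWithinAt

open Classical in
/-- The moves `φ`, switched off outside `{V ≤ a}`. -/
noncomputable def truncMoves (φ : ι → S → S) (V : S → ℝ) (a : ℝ) (i : ι) (ξ : S) : S :=
  if V ξ ≤ a then φ i ξ else ξ

theorem jumpGen_truncMoves_of_le {a : ℝ} {ξ : S} (hξ : V ξ ≤ a) (f : S → ℝ) :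
    jumpGen (truncMoves φ V a) r f ξ = jumpGen φ r f ξ := by
  simp [jumpGen, truncMoves, hξ]

theorem jumpGen_truncMoves_of_lt {a : ℝ} {ξ : S} (hξ : a < V ξ) (f : S → ℝ) :
    jumpGen (truncMoves φ V a) r f ξ = 0 := by
  simp [jumpGen, truncMoves, not_le.2 hξ]

/-- The drift of `V` is either unchanged or zero, so the same `V` and `c` serve every truncation
level; this makes the later estimates uniform in `a`. -/
theorem IsLyapunov.trunc (h : IsLyapunov φ r V c) (a : ℝ) :
    IsLyapunov (truncMoves φ V a) r V c where
  rate_nonneg := h.rate_nonneg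
  finite_moves ξ := by
    refine (h.finite_moves ξ).subset fun i hi => ?_
    simp only [truncMoves, Set.mem_ofPred_eq] at hi ⊢
    grind
  nonneg := h.nonneg
  finite_sublevel := h.finite_sublevel
  const_nonneg := h.const_nonneg
  drift ξ := by
    rcases le_or_gt (V ξ) a with hξ | hξ
    · rw [jumpGen_truncMoves_of_le hξ]
      exact h.drift ξ
    · rw [jumpGen_truncMoves_of_lt hξ]
      exact h.const_nonneg

theorem IsLyapunov.exists_isSolution_trunc (h : IsLyapunov φ r V c) (a : ℝ) {f : S → ℝ}
    (hf : Bdd f) : ∃ u, IsSolution (truncMoves φ V a) r f u := by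
  obtain ⟨B, hB⟩ := ((h.finite_sublevel a).image
    fun ξ => ∑ i ∈ (h.finite_moves ξ).toFinset, r i).bddAbove
  -- The finite sublevel set supplies `B`; the `0` covers the states outside it, where no move is
  -- active.
  refine (h.trunc a).exists_isSolution_of_bdd_rates (B := max B 0) (fun ξ => ?_) hf
  rcases le_or_gt (V ξ) a with hξ | hξ
  · refine le_trans (le_of_eq ?_) ((hB ⟨ξ, hξ, rfl⟩).trans (le_max_left _ _))
    refine Finset.sum_congr ?_ fun _ _ => rfl
    ext i
    simp [truncMoves, hξ]
  · refine le_trans (le_of_eq ?_) (le_max_right _ _)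
    refine Finset.sum_eq_zero fun i hi => ?_
    simp [truncMoves, not_le.2 hξ] at hi

/-- Solutions for different truncations are close. -/
theorem IsLyapunov.trunc_sub_le (h : IsLyapunov φ r V c) {f : S → ℝ} {C a b : ℝ}
    (hC : ∀ ξ, |f ξ| ≤ C) (ha : 0 < a) (hab : a ≤ b) {u v : ℝ → S → ℝ}
    (hu : IsSolution (truncMoves φ V a) r f u) (hv : IsSolution (truncMoves φ V b) r f v)
    {t : ℝ} (ht : 0 ≤ t) (ξ : S) :
    |u t ξ - v t ξ| ≤ 2 * C / a * (V ξ + c * t) := by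
  have hub := fun t (ht : 0 ≤ t) ξ => _root_.abs_le.1 (hu.abs_le (h.trunc a) hC ht ξ)
  have hvb := fun t (ht : 0 ≤ t) ξ => _root_.abs_le.1 (hv.abs_le (h.trunc b) hC ht ξ)
  have hC0 : 0 ≤ C := (abs_nonneg _).trans (hC ξ)
  set K := 2 * C / a with hK
  have hK0 : 0 ≤ K := by positivity
  have hKa : K * a = 2 * C := by rw [hK]; field_simp
  have main : ∀ σ : ℝ, |σ| = 1 → σ * (u t ξ - v t ξ) - K * (V ξ + c * t) ≤ 0 := by
    intro σ hσ
    have hbd : ∀ t, 0 ≤ t → ∀ ξ, σ * (u t ξ - v t ξ) ≤ 2 * C := by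
      intro t ht ξ
      refine (le_abs_self _).trans ?_
      rw [abs_mul, hσ, one_mul]
      have h1 := hub t ht ξ
      have h2 := hvb t ht ξ
      exact _root_.abs_le.2 ⟨by linarith [h1.1, h2.2], by linarith [h1.2, h2.1]⟩
    refine h.nonpos_of_subsolution
      (u := fun t ξ => σ * (u t ξ - v t ξ) - K * (V ξ + c * t))
      (u' := fun t ξ => σ * (jumpGen (truncMoves φ V a) r (u t) ξ -
        jumpGen (truncMoves φ V b) r (v t) ξ) - K * (c * 1)) ?_ ?_ ?_ ?_ ht ξ
    · refine fun T => ⟨2 * C, fun t ht ξ => ?_⟩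
      have h1 := hbd t ht.1 ξ
      have h2 : 0 ≤ K * (V ξ + c * t) :=
        mul_nonneg hK0 (add_nonneg (h.nonneg ξ) (mul_nonneg h.const_nonneg ht.1))
      linarith
    · intro ξ
      have : 0 ≤ K * V ξ := mul_nonneg hK0 (h.nonneg ξ)
      simpa [hu.init, hv.init] using this
    · exact fun t ht ξ => (((hu.deriv t ht ξ).sub (hv.deriv t ht ξ)).const_mul σ).sub
        ((((hasDerivAt_id t).const_mul c).const_add (V ξ)).const_mul K).hasDerivWithinAt
    · intro t ht ξ hpos
      -- By the choice `K * a = 2 * C`, the difference can exceed the barrier only inside `{V ≤ a}`,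
      -- where both truncated generators agree with the full one.
      have hξ : V ξ ≤ a := by
        by_contra! hlt
        have h1 := hbd t ht ξ
        have h2 := mul_le_mul_of_nonneg_left hlt.le hK0
        have h3 := mul_nonneg hK0 (mul_nonneg h.const_nonneg ht)
        nlinarith
      rw [jumpGen_truncMoves_of_le hξ, jumpGen_truncMoves_of_le (hξ.trans hab)]
      have h1 : jumpGen φ r (fun ξ => σ * (u t ξ - v t ξ) - K * (V ξ + c * t)) ξ =
          σ * (jumpGen φ r (u t) ξ - jumpGen φ r (v t) ξ) - K * jumpGen φ r V ξ := by
        rw [h.jumpGen_sub, h.jumpGen_mul, h.jumpGen_mul, h.jumpGen_sub, h.jumpGen_add_const]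
      rw [h1]
      have := mul_le_mul_of_nonneg_left (h.drift ξ) hK0
      linarith
  have h1 := main 1 (by simp)
  have h2 := main (-1) (by simp)
  exact _root_.abs_le.2 ⟨by linarith, by linarith⟩

end Solutions

/-! ### Existence for bounded initial values by removing the truncation. -/

section Existence

variable {S ι : Type*} {φ : ι → S → S} {r : ι → ℝ} {V : S → ℝ} {c : ℝ}

theorem tendstoUniformlyOn_of_abs_sub_le {u : ℕ → ℝ → ℝ} {v : ℝ → ℝ} {s : Set ℝ} {D : ℝ}
    (h : ∀ᶠ n : ℕ in atTop, ∀ t ∈ s, |u n t - v t| ≤ D / ((n : ℝ) + 1)) :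
    TendstoUniformlyOn u v atTop s := by
  rw [Metric.tendstoUniformlyOn_iff]
  intro ε hε
  have hD : Tendsto (fun n : ℕ => D / ((n : ℝ) + 1)) atTop (𝓝 0) := by
    have := tendsto_one_div_add_atTop_nhds_zero_nat (𝕜 := ℝ)
    simpa [div_eq_mul_inv] using this.const_mul D
  filter_upwards [h, hD.eventually_lt_const hε] with n hn hn' t ht
  rw [dist_comm, Real.dist_eq]
  exact (hn t ht).trans_lt hn'

/-- Existence of solutions of the backward equation for bounded initial values. -/
theorem IsLyapunov.exists_isSolution (h : IsLyapunov φ r V c) {f : S → ℝ} (hf : Bdd f) :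
    ∃ u, IsSolution φ r f u := by
  obtain ⟨C, hC⟩ := id hf
  choose U hU using fun n : ℕ => h.exists_isSolution_trunc ((n : ℝ) + 1) hf
  have hpos : ∀ n : ℕ, (0 : ℝ) < (n : ℝ) + 1 := fun n => by positivity
  have hUC : ∀ n t, 0 ≤ t → ∀ ξ, |U n t ξ| ≤ C := fun n t ht ξ =>
    (hU n).abs_le (h.trunc _) hC ht ξ
  have hcau : ∀ n m : ℕ, n ≤ m → ∀ t, 0 ≤ t → ∀ ξ,
      |U n t ξ - U m t ξ| ≤ 2 * C * (V ξ + c * t) / ((n : ℝ) + 1) := by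
    intro n m hnm t ht ξ
    have h1 : (n : ℝ) + 1 ≤ m + 1 := by gcongr
    refine (h.trunc_sub_le hC (hpos n) h1 (hU n) (hU m) ht ξ).trans (le_of_eq ?_)
    ring
  -- The limit is chosen for every real time; its value at negative times is irrelevant.
  have hlim : ∀ t ξ, ∃ l, 0 ≤ t → Tendsto (fun n => U n t ξ) atTop (𝓝 l) := by
    intro t ξ
    by_cases ht : 0 ≤ t
    · have hz : Tendsto (fun n : ℕ => 2 * C * (V ξ + c * t) / ((n : ℝ) + 1)) atTop (𝓝 0) := by
        have := tendsto_one_div_add_atTop_nhds_zero_nat (𝕜 := ℝ)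
        simpa [div_eq_mul_inv] using this.const_mul (2 * C * (V ξ + c * t))
      have : CauchySeq fun n => U n t ξ := cauchySeq_of_le_tendsto_0' _
        (fun n m hnm => by rw [Real.dist_eq]; exact hcau n m hnm t ht ξ) hz
      obtain ⟨l, hl⟩ := cauchySeq_tendsto_of_complete this
      exact ⟨l, fun _ => hl⟩
    · exact ⟨0, fun h => absurd h ht⟩
  choose v hv using hlim
  have herr : ∀ n : ℕ, ∀ t, 0 ≤ t → ∀ ξ,
      |U n t ξ - v t ξ| ≤ 2 * C * (V ξ + c * t) / ((n : ℝ) + 1) := by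
    intro n t ht ξ
    refine le_of_tendsto (((hv t ξ ht).const_sub (U n t ξ)).abs) ?_
    filter_upwards [eventually_ge_atTop n] with m hm using hcau n m hm t ht ξ
  have hC0 : ∀ ξ : S, 0 ≤ C := fun ξ => (abs_nonneg _).trans (hC ξ)
  have herrT : ∀ T, 0 ≤ T → ∀ ξ, ∀ n : ℕ, ∀ t ∈ Set.Icc 0 T,
      |U n t ξ - v t ξ| ≤ 2 * C * (V ξ + c * T) / ((n : ℝ) + 1) := by
    intro T hT ξ n t ht
    refine (herr n t ht.1 ξ).trans ?_
    have := hC0 ξ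
    have := h.const_nonneg
    have := ht.2
    gcongr
  have hunif : ∀ T, 0 ≤ T → ∀ ξ,
      TendstoUniformlyOn (fun n t => U n t ξ) (fun t => v t ξ) atTop (Set.Icc 0 T) :=
    fun T hT ξ => tendstoUniformlyOn_of_abs_sub_le (Eventually.of_forall (herrT T hT ξ))
  have hcont : ∀ ξ, ContinuousOn (fun t => v t ξ) (Set.Ici 0) := by
    intro ξ t ht
    have ht : 0 ≤ t := ht
    have h1 : ContinuousOn (fun t => v t ξ) (Set.Icc 0 (t + 1)) :=
      (hunif (t + 1) (by linarith) ξ).continuousOn (Eventually.of_forall fun n =>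
        ((hU n).continuousOn ξ).mono Set.Icc_subset_Ici_self).frequently
    refine (h1 t ⟨ht, by linarith⟩).mono_of_mem_nhdsWithin ?_
    have : Set.Ici 0 ∩ Set.Iio (t + 1) ⊆ Set.Icc 0 (t + 1) := fun x hx => ⟨hx.1, hx.2.le⟩
    exact mem_of_superset (inter_mem_nhdsWithin _ (Iio_mem_nhds (by linarith))) this
  have hgen : ∀ T, 0 ≤ T → ∀ ξ, TendstoUniformlyOn
      (fun (n : ℕ) t => jumpGen (truncMoves φ V ((n : ℝ) + 1)) r (U n t) ξ)
      (fun t => jumpGen φ r (v t) ξ) atTop (Set.Icc 0 T) := by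
    intro T hT ξ
    -- `M` bounds `V` at `ξ` and all its neighbours, so one error bound serves all terms of the
    -- generator.
    obtain ⟨M, hM⟩ := (((h.finite_moves ξ).toFinset.finite_toSet.image
      fun i => V (φ i ξ)).union (Set.finite_singleton (V ξ))).bddAbove
    refine tendstoUniformlyOn_of_abs_sub_le
      (D := (∑ i ∈ (h.finite_moves ξ).toFinset, r i) * (2 * (2 * C * (M + c * T)))) ?_
    filter_upwards [eventually_ge_atTop ⌈V ξ⌉₊] with n hn t ht
    have hVn : V ξ ≤ (n : ℝ) + 1 := by
      have := Nat.ceil_le.1 hn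
      linarith
    rw [jumpGen_truncMoves_of_le hVn, ← h.jumpGen_sub]
    have hb : ∀ η, V η ≤ M → |U n t η - v t η| ≤ 2 * C * (M + c * T) / ((n : ℝ) + 1) := by
      intro η hη
      refine (herrT T hT η n t ht).trans ?_
      have := hC0 ξ
      gcongr
    refine (h.abs_jumpGen_le ξ (hb ξ (hM (Or.inr rfl)))
      fun i hi => hb _ (hM (Or.inl ⟨i, hi, rfl⟩))).trans (le_of_eq ?_)
    ring
  have hder : ∀ t, 0 < t → ∀ ξ, HasDerivAt (fun s => v s ξ) (jumpGen φ r (v t) ξ) t := by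
    intro t ht ξ
    refine hasDerivAt_of_tendstoUniformlyOn (s := Set.Ioo 0 (t + 1)) isOpen_Ioo
      ((hgen (t + 1) (by linarith) ξ).mono Set.Ioo_subset_Icc_self)
      (Eventually.of_forall fun n s hs => ?_) (fun s hs => hv s ξ hs.1.le) ⟨ht, by linarith⟩
    exact ((hU n).deriv s hs.1.le ξ).hasDerivAt (Ici_mem_nhds hs.1)
  have hjc : ∀ ξ, ContinuousOn (fun t => jumpGen φ r (v t) ξ) (Set.Ici 0) := by
    intro ξ
    simp only [h.jumpGen_eq]
    exact continuousOn_finsetSum _ fun i _ =>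
      continuousOn_const.mul ((hcont _).sub (hcont ξ))
  refine ⟨v, ?_, ?_, ?_⟩
  · ext ξ
    refine tendsto_nhds_unique (hv 0 ξ le_rfl) ?_
    simp only [(hU _).init]
    exact tendsto_const_nhds
  · exact fun T => ⟨C, fun t ht ξ => le_of_tendsto (hv t ξ ht.1).abs
      (Eventually.of_forall fun n => hUC n t ht.1 ξ)⟩
  · intro t ht ξ
    -- Uniform convergence of derivatives is used on open time intervals; at time zero the one-sided
    -- derivative is the limit of the derivatives at positive times.
    rcases ht.eq_or_lt with rfl | ht
    · refine hasDerivWithinAt_Ici_of_tendsto_deriv (s := Set.Ioi 0)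
        (fun s hs => (hder s hs ξ).differentiableAt.differentiableWithinAt)
        ((hcont ξ 0 Set.self_mem_Ici).mono Set.Ioi_subset_Ici_self) self_mem_nhdsWithin ?_
      refine ((hjc ξ 0 Set.self_mem_Ici).mono Set.Ioi_subset_Ici_self).congr' ?_
      filter_upwards [self_mem_nhdsWithin] with s hs using (hder s hs ξ).deriv.symm
    · exact (hder t ht ξ).hasDerivWithinAt

end Existence

/-! ### Representing tight positive functionals by probability measures. -/

section Representation

variable {S : Type*} [MeasurableSpace S] [DiscreteMeasurableSpace S]

theorem Bdd.integrable {f : S → ℝ} (hf : Bdd f) (μ : Measure S) [IsFiniteMeasure μ] :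
    Integrable f μ := by
  obtain ⟨C, hC⟩ := hf
  exact Integrable.of_bound (C := C) (Measurable.of_discrete).aestronglyMeasurable
    (Eventually.of_forall hC)

/-- A tight positive normalized linear functional on the bounded functions on a countable discrete
space is the integral with respect to a probability measure. -/
theorem exists_measure_of_tight [Countable S] (Λ : (S → ℝ) → ℝ)
    (hadd : ∀ f g, Bdd f → Bdd g → Λ (f + g) = Λ f + Λ g)
    (hsmul : ∀ (a : ℝ) f, Bdd f → Λ (a • f) = a * Λ f)
    (hpos : ∀ f, Bdd f → (∀ ξ, 0 ≤ f ξ) → 0 ≤ Λ f) (hone : Λ (fun _ => 1) = 1)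
    (htight : ∀ ε, 0 < ε → ∃ F : Finset S, Λ ((F : Set S)ᶜ.indicator fun _ => 1) ≤ ε) :
    ∃ μ : Measure S, IsProbabilityMeasure μ ∧ ∀ f, Bdd f → ∫ ξ, f ξ ∂μ = Λ f := by
  classical
  have hmono : ∀ f g, Bdd f → Bdd g → (∀ ξ, f ξ ≤ g ξ) → Λ f ≤ Λ g := by
    intro f g hf hg hfg
    have h1 := hpos (g - f) (hg.sub hf) fun ξ => sub_nonneg.2 (hfg ξ)
    have h2 := hadd (g - f) f (hg.sub hf) hf
    rw [sub_add_cancel] at h2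
    linarith
  set p : S → ℝ := fun η => Λ (({η} : Set S).indicator fun _ => 1) with hp
  have hp0 : ∀ η, 0 ≤ p η := fun η =>
    hpos _ (bdd_indicator _) fun ξ => Set.indicator_nonneg (fun _ _ => zero_le_one) ξ
  have hfin : ∀ (f : S → ℝ) (F : Finset S), Bdd f →
      Λ ((F : Set S).indicator f) = ∑ η ∈ F, p η * f η := by
    intro f F hf
    induction F using Finset.induction_on with
    | empty =>
      have := hsmul 0 0 (bdd_const 0)
      rw [zero_smul, zero_mul] at this
      simp only [Finset.coe_empty, Set.indicator_empty, Finset.sum_empty]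
      exact this
    | insert η F hη ih =>
      have h1 : ((insert η F : Finset S) : Set S).indicator f =
          f η • (({η} : Set S).indicator fun _ => (1 : ℝ)) + (F : Set S).indicator f := by
        ext ξ
        by_cases h1 : ξ = η
        · subst h1; simp [hη]
        · simp [Set.indicator, h1]
      have h2 : Bdd ((F : Set S).indicator f) := by
        obtain ⟨C, hC⟩ := hf
        refine ⟨C, fun ξ => ?_⟩
        by_cases hξ : ξ ∈ F
        · simpa [hξ] using hC ξ
        · simpa [hξ] using (abs_nonneg _).trans (hC ξ)
      rw [h1, hadd _ _ ((bdd_indicator _).smul _) h2, hsmul _ _ (bdd_indicator _), ih,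
        Finset.sum_insert hη, mul_comm]
  -- Positivity bounds the part of `f` outside a large finite set by a multiple of the mass there,
  -- which tightness makes small. So `Λ` is determined by its point masses `p`.
  have hsum : ∀ f, Bdd f → HasSum (fun η => p η * f η) (Λ f) := by
    intro f hf
    obtain ⟨C, hC⟩ := id hf
    rw [HasSum, Metric.tendsto_nhds]
    intro ε hε
    have hC' : 0 < |C| + 1 := by positivity
    obtain ⟨F, hF⟩ := htight (ε / 2 / (|C| + 1)) (by positivity)
    simp only [SummationFilter.unconditional_filter]
    filter_upwards [eventually_ge_atTop F] with G hG
    rw [← hfin f G hf, Real.dist_eq]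
    have hGc : Bdd ((F : Set S)ᶜ.indicator fun _ => (1 : ℝ)) := bdd_indicator _
    have hfG : Bdd ((G : Set S).indicator f) := by
      refine ⟨|C|, fun ξ => ?_⟩
      by_cases hξ : ξ ∈ G
      · simpa [hξ] using (hC ξ).trans (le_abs_self C)
      · simp [hξ]
    have hdom : ∀ σ : ℝ, |σ| = 1 → Λ (σ • (f - (G : Set S).indicator f)) ≤ ε / 2 := by
      intro σ hσ
      have h1 : Λ ((|C| + 1) • (F : Set S)ᶜ.indicator fun _ => (1 : ℝ)) ≤ ε / 2 := by
        rw [hsmul _ _ hGc]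
        calc (|C| + 1) * _ ≤ (|C| + 1) * (ε / 2 / (|C| + 1)) := by gcongr
          _ = ε / 2 := by field_simp
      refine (hmono _ _ ((hf.sub hfG).smul σ) (hGc.smul _) fun ξ => ?_).trans h1
      by_cases hξ : ξ ∈ G
      · have : 0 ≤ (F : Set S)ᶜ.indicator (fun _ => (1 : ℝ)) ξ :=
          Set.indicator_nonneg (fun _ _ => zero_le_one) ξ
        simp only [Pi.smul_apply, Pi.sub_apply, Finset.mem_coe, hξ, Set.indicator_of_mem,
          sub_self, smul_eq_mul, mul_zero]
        exact mul_nonneg hC'.le this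
      · have hξF : ξ ∉ F := fun h => hξ (hG h)
        simp only [Pi.smul_apply, Pi.sub_apply, Finset.mem_coe, hξ, not_false_eq_true,
          Set.indicator_of_notMem, sub_zero, Set.mem_compl_iff, hξF, Set.indicator_of_mem,
          smul_eq_mul, mul_one]
        refine (le_abs_self _).trans ?_
        rw [abs_mul, hσ, one_mul]
        linarith [hC ξ, le_abs_self C]
    have hsub : Λ (f - (G : Set S).indicator f) = Λ f - Λ ((G : Set S).indicator f) := by
      have := hadd _ _ (hf.sub hfG) hfG
      rw [sub_add_cancel] at this
      linarith
    have h1 := hdom 1 (by simp)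
    have h2 := hdom (-1) (by simp)
    rw [hsmul _ _ (hf.sub hfG), hsub] at h1 h2
    have : |Λ ((G : Set S).indicator f) - Λ f| ≤ ε / 2 := abs_le.2 ⟨by linarith, by linarith⟩
    linarith
  have hp1 : HasSum p 1 := by
    have := hsum (fun _ => 1) (bdd_const 1)
    simpa [hone] using this
  set μ : Measure S := Measure.sum fun η => ENNReal.ofReal (p η) • Measure.dirac η with hμ
  have hμs : ∀ η, μ {η} = ENNReal.ofReal (p η) := by
    intro η
    rw [hμ, Measure.sum_apply _ (MeasurableSet.singleton η), tsum_eq_single η]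
    · simp
    · intro ζ hζ
      simp [hζ]
  have hμ1 : IsProbabilityMeasure μ := by
    refine ⟨?_⟩
    rw [hμ, Measure.sum_apply _ MeasurableSet.univ]
    simp only [Measure.smul_apply, measure_univ, smul_eq_mul, mul_one]
    rw [← ENNReal.ofReal_tsum_of_nonneg hp0 hp1.summable, hp1.tsum_eq, ENNReal.ofReal_one]
  refine ⟨μ, hμ1, fun f hf => ?_⟩
  rw [integral_countable (hf.integrable μ), ← (hsum f hf).tsum_eq]
  refine tsum_congr fun η => ?_
  rw [measureReal_def, hμs, ENNReal.toReal_ofReal (hp0 η), smul_eq_mul]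

end Representation

/-! ### From solutions of the backward equation to a Markov semigroup. -/

section Semigroup

variable {S ι : Type*} {φ : ι → S → S} {r : ι → ℝ} {V : S → ℝ} {c : ℝ}
variable [MeasurableSpace S] [DiscreteMeasurableSpace S]

theorem measure_ext_of_forall_integral {S : Type*} [MeasurableSpace S] {μ ν : Measure S} [IsFiniteMeasure μ]
    [IsFiniteMeasure ν] (h : ∀ f : S → ℝ, Bdd f → ∫ ξ, f ξ ∂μ = ∫ ξ, f ξ ∂ν) : μ = ν := by
  ext A hA
  have := h (A.indicator fun _ => 1) (bdd_indicator A)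
  rw [integral_indicator_const _ hA, integral_indicator_const _ hA] at this
  simpa [measureReal_def, ENNReal.toReal_eq_toReal_iff] using this

theorem Bdd.kernel_integral {S : Type*} [MeasurableSpace S] {f : S → ℝ} (hf : Bdd f) (κ : Kernel S S) [IsMarkovKernel κ] :
    Bdd fun ξ => ∫ η, f η ∂κ ξ := by
  obtain ⟨C, hC⟩ := hf
  refine ⟨C, fun ξ => ?_⟩
  simpa using norm_integral_le_of_norm_le_const (μ := κ ξ)
    (Eventually.of_forall fun η => (Real.norm_eq_abs (f η)).trans_le (hC η))

theorem Bdd.integral_bind {f : S → ℝ} (hf : Bdd f) (μ : Measure S) [IsProbabilityMeasure μ]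
    (κ : Kernel S S) [IsMarkovKernel κ] :
    ∫ η, f η ∂(μ.bind κ) = ∫ ξ, ∫ η, f η ∂κ ξ ∂μ := by
  have h1 : (κ ∘ₖ Kernel.const Unit μ) () = μ.bind κ := by simp
  have := Kernel.integral_comp (κ := Kernel.const Unit μ) (η := κ) (a := ()) (f := f)
    (hf.integrable _)
  rw [h1] at this
  simpa using this

/-- The backward equation is solved by a semigroup of Markov kernels. -/
theorem IsLyapunov.exists_semigroup [Countable S] (h : IsLyapunov φ r V c) :
    ∃ P : ℝ≥0 → Kernel S S, (∀ t, IsMarkovKernel (P t)) ∧ P 0 = Kernel.id ∧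
      (∀ s t, P (s + t) = (P t).comp (P s)) ∧
      ∀ f, Bdd f → IsSolution φ r f fun t ξ => ∫ η, f η ∂(P t.toNNReal ξ) := by
  have hex : ∀ f : S → ℝ, ∃ u, Bdd f → IsSolution φ r f u := by
    intro f
    by_cases hf : Bdd f
    · obtain ⟨u, hu⟩ := h.exists_isSolution hf
      exact ⟨u, fun _ => hu⟩
    · exact ⟨0, fun h => absurd h hf⟩
  choose U hU using hex
  have hmeas : ∀ (t : ℝ≥0) (ξ : S), ∃ μ : Measure S, IsProbabilityMeasure μ ∧
      ∀ f, Bdd f → ∫ η, f η ∂μ = U f t ξ := by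
    intro t ξ
    refine exists_measure_of_tight (fun f => U f t ξ) ?_ ?_ ?_ ?_ ?_
    · exact fun f g hf hg =>
        (hU _ (hf.add hg)).unique h ((hU f hf).add h (hU g hg)) t.coe_nonneg ξ
    · exact fun a f hf => (hU _ (hf.smul a)).unique h ((hU f hf).smul h a) t.coe_nonneg ξ
    · exact fun f hf h0 => (isSolution_const 0).mono h (hU f hf) h0 t.coe_nonneg ξ
    · exact (hU _ (bdd_const 1)).unique h (isSolution_const 1) t.coe_nonneg ξ
    · intro ε hε
      -- A Markov inequality: the indicator of `{V > m}` lies below `V / m`, so `le_lyapunov` bounds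
      -- its evolution by `(V ξ + c * t) / m`, which this `m` makes at most `ε`.
      set m := (V ξ + c * t) / ε + 1 with hm
      have h0 : 0 ≤ V ξ + c * t := add_nonneg (h.nonneg ξ) (mul_nonneg h.const_nonneg t.2)
      have hm0 : 0 < m := by positivity
      refine ⟨(h.finite_sublevel m).toFinset, ?_⟩
      have := (hU _ (bdd_indicator _)).le_lyapunov h
        (f := (((h.finite_sublevel m).toFinset : Set S)ᶜ.indicator fun _ => 1)) hm0 ?_ t.coe_nonneg ξ
      · refine le_of_mul_le_mul_left (this.trans ?_) hm0
        rw [hm, add_mul, div_mul_cancel₀ _ hε.ne']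
        linarith
      · intro η
        by_cases hη : V η ≤ m
        · simpa [hη] using h.nonneg η
        · simpa [hη] using (not_le.1 hη).le
  choose μ hμ1 hμ using hmeas
  let P : ℝ≥0 → Kernel S S := fun t => Kernel.ofFunOfCountable (μ t)
  have hP : ∀ t f ξ, Bdd f → ∫ η, f η ∂(P t ξ) = U f t ξ := fun t f ξ hf => hμ t ξ f hf
  have hM : ∀ t, IsMarkovKernel (P t) := fun t => ⟨fun ξ => hμ1 t ξ⟩
  refine ⟨P, hM, ?_, ?_, fun f hf => ?_⟩
  · ext1 ξ
    refine measure_ext_of_forall_integral fun f hf => ?_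
    rw [hP 0 f ξ hf, Kernel.id_apply, integral_dirac, NNReal.coe_zero, (hU f hf).init]
  · intro s t
    ext1 ξ
    refine measure_ext_of_forall_integral fun f hf => ?_
    have hft := hf.kernel_integral (P t)
    rw [hP _ f ξ hf, Kernel.integral_comp (hf.integrable _), hP s _ ξ hft, add_comm s t]
    -- The solution shifted by `t` and the solution started from its value at time `t` coincide by
    -- uniqueness; this is the semigroup property.
    have h1 := (hU f hf).shift t.coe_nonneg
    have h2 : (fun ξ => ∫ η, f η ∂(P t ξ)) = U f t := funext fun ξ => hP t f ξ hf
    have h3 := hU _ hft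
    rw [h2] at h3 ⊢
    rw [h3.unique h h1 s.coe_nonneg ξ, NNReal.coe_add, add_comm (t : ℝ)]
  · have : ∀ t : ℝ, 0 ≤ t → (fun ξ => ∫ η, f η ∂(P t.toNNReal ξ)) = U f t := by
      intro t ht
      ext ξ
      rw [hP _ f ξ hf, Real.coe_toNNReal t ht]
    refine ⟨?_, ?_, ?_⟩
    · rw [this 0 le_rfl, (hU f hf).init]
    · intro T
      obtain ⟨C, hC⟩ := (hU f hf).locally_bdd T
      refine ⟨C, fun t ht ξ => ?_⟩
      rw [congrFun (this t ht.1) ξ]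
      exact hC t ht ξ
    · intro t ht ξ
      rw [this t ht]
      exact ((hU f hf).deriv t ht ξ).congr (fun s hs => congrFun (this s hs) ξ)
        (congrFun (this t ht) ξ)

end Semigroup

/-! ### Geometry of interfaces: height, support and area. -/

namespace Interface

theorem lipschitz (ξ : Interface) (x : ℤ) (n : ℕ) : |ξ.toFun (x + n) - ξ.toFun x| ≤ n := by
  induction n with
  | zero => simp
  | succ n ih =>
    have := ξ.step (x + n)
    push_cast
    rw [← add_assoc]
    grind

theorem abs_sub_le (ξ : Interface) {x y : ℤ} (h : x ≤ y) : |ξ.toFun y - ξ.toFun x| ≤ y - x := by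
  obtain ⟨n, rfl⟩ := Int.le.dest h
  simpa using ξ.lipschitz x n

theorem exists_eq_abs (ξ : Interface) : ∃ n : ℕ, ∀ x : ℤ, (n : ℤ) ≤ |x| → ξ.toFun x = |x| := by
  obtain ⟨M, hM⟩ := (ξ.finite_ne.image fun x => |x|).bddAbove
  refine ⟨(M + 1).toNat, fun x hx => ?_⟩
  by_contra h
  have h1 : |x| ≤ M := hM ⟨x, by simpa [cone_zero] using h, rfl⟩
  omega

/-- An interface is 1-Lipschitz and agrees with the cone far out on both sides, so it cannot dip
below the cone in between. -/
theorem abs_le_toFun (ξ : Interface) (x : ℤ) : |x| ≤ ξ.toFun x := by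
  obtain ⟨n, hn⟩ := ξ.exists_eq_abs
  have h1 := hn (n + |x|) (by grind)
  have h2 := hn (-(n + |x|)) (by grind)
  have h3 := ξ.abs_sub_le (x := x) (y := n + |x|) (by grind)
  have h4 := ξ.abs_sub_le (x := -(n + |x|)) (y := x) (by grind)
  grind

theorem coneO_le (ξ : Interface) : coneO ≤ ξ := fun x => by
  have := ξ.abs_le_toFun x
  rwa [← cone_zero] at this

/-- The excess `ξ(x) - |x|` of an interface over the cone is even. -/
theorem excess_even (ξ : Interface) (x : ℤ) : (ξ.toFun x - |x|) % 2 = 0 := by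
  have := ξ.parity x
  grind

/-- The sites at which an interface differs from the cone. -/
noncomputable def supp (ξ : Interface) : Finset ℤ := ξ.finite_ne.toFinset

theorem mem_supp (ξ : Interface) (x : ℤ) : x ∈ ξ.supp ↔ ξ.toFun x ≠ |x| := by
  simp [supp, cone_zero]

theorem supp_mono {ξ η : Interface} (h : ξ ≤ η) : ξ.supp ⊆ η.supp := by
  intro x hx
  rw [mem_supp] at hx ⊢
  have h1 := h x
  have h2 := ξ.abs_le_toFun x
  change ξ.toFun x ≤ η.toFun x at h1
  omega

/-- The area between an interface and the cone. -/
noncomputable def area (ξ : Interface) : ℤ := ∑ x ∈ ξ.supp, (ξ.toFun x - |x|)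

theorem area_eq_sum (ξ : Interface) {s : Finset ℤ} (hs : ∀ x, ξ.toFun x ≠ |x| → x ∈ s) :
    ξ.area = ∑ x ∈ s, (ξ.toFun x - |x|) := by
  refine Finset.sum_subset (fun x hx => hs x ((ξ.mem_supp x).1 hx)) fun x _ hx => ?_
  rw [mem_supp, not_not] at hx
  rw [hx, sub_self]

theorem card_supp_le_area (ξ : Interface) : (ξ.supp.card : ℤ) ≤ ξ.area := by
  rw [Finset.card_eq_sum_ones, Nat.cast_sum]
  refine Finset.sum_le_sum fun x hx => ?_
  have h1 := ξ.abs_le_toFun x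
  have h2 := (ξ.mem_supp x).1 hx
  push_cast
  omega

theorem area_nonneg (ξ : Interface) : 0 ≤ ξ.area :=
  le_trans (Int.natCast_nonneg _) ξ.card_supp_le_area

theorem eq_coneO_of_card_supp_eq_zero {ξ : Interface} (h : ξ.supp.card = 0) : ξ = coneO := by
  ext x
  rw [Finset.card_eq_zero] at h
  have h1 := (ξ.mem_supp x).not.1 (by rw [h]; exact Finset.notMem_empty x)
  rw [not_not] at h1
  rw [h1, ← cone_zero]
  rfl

/-- Once an interface touches the cone, the Lipschitz bound keeps it there further out on that side.
So the support contains all `|x| + 1` sites from `0` to `x`. -/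
theorem abs_lt_card_supp {ξ : Interface} {x : ℤ} (hx : ξ.toFun x ≠ |x|) :
    |x| < ξ.supp.card := by
  have h1 := ξ.abs_le_toFun x
  rcases le_total 0 x with h0 | h0
  · have hsub : Finset.Icc 0 x ⊆ ξ.supp := by
      intro y hy
      rw [Finset.mem_Icc] at hy
      rw [mem_supp]
      intro h
      have := ξ.abs_sub_le hy.2
      grind
    have := Finset.card_le_card hsub
    rw [Int.card_Icc] at this
    grind
  · have hsub : Finset.Icc x 0 ⊆ ξ.supp := by
      intro y hy
      rw [Finset.mem_Icc] at hy
      rw [mem_supp]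
      intro h
      have := ξ.abs_sub_le hy.1
      grind
    have := Finset.card_le_card hsub
    rw [Int.card_Icc] at this
    grind

/-- Such an interface equals the cone from distance `n` on, and by the Lipschitz bound from the
height `n` at site `n` its values on `[-n, n]` are at most `3 * n`; the box used is slightly larger.
-/
theorem finite_card_supp_le (n : ℕ) : {ξ : Interface | ξ.supp.card ≤ n}.Finite := by
  have hfin : (Set.univ.pi fun _ : Finset.Icc (-(n : ℤ)) n =>
      Set.Icc (0 : ℤ) (3 * n + 3)).Finite := Set.Finite.pi fun _ => Set.finite_Icc _ _
  have hout : ∀ ξ : Interface, ξ.supp.card ≤ n → ∀ x : ℤ, (n : ℤ) ≤ |x| → ξ.toFun x = |x| := by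
    intro ξ hξ x hx
    by_contra h
    have := abs_lt_card_supp h
    omega
  refine Set.Finite.of_finite_image (f := fun ξ (x : Finset.Icc (-(n : ℤ)) n) => ξ.toFun x)
    (hfin.subset ?_) ?_
  · rintro _ ⟨ξ, hξ, rfl⟩ ⟨x, hx⟩ _
    rw [Finset.mem_Icc] at hx
    have h1 := hout ξ hξ n (by simp)
    have h2 := ξ.abs_sub_le hx.2
    have h3 := ξ.abs_le_toFun x
    simp only [Set.mem_Icc]
    grind
  · intro ξ hξ η hη h
    ext x
    by_cases hx : x ∈ Finset.Icc (-(n : ℤ)) n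
    · exact congrFun h ⟨x, hx⟩
    · rw [Finset.mem_Icc] at hx
      rw [hout ξ hξ x (by grind), hout η hη x (by grind)]

/-! ### Monotone moves and their effect on the area. -/

/-- The heat bath update which raises `ξ` at `x` if `x` is a local minimum. -/
def raise (x : ℤ) (ξ : Interface) : Interface where
  toFun y := if y = x then min (ξ.toFun (x - 1)) (ξ.toFun (x + 1)) + 1 else ξ.toFun y
  step y := by
    have h1 := ξ.step y
    have h2 := ξ.step x
    have h3 := ξ.step (x - 1)
    rw [sub_add_cancel] at h3
    grind
  finite_ne := by
    refine (ξ.finite_ne.union (Set.finite_singleton x)).subset fun y hy => ?_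
    by_cases h : y = x
    · exact Or.inr h
    · left
      simpa [h] using hy

/-- The heat bath update which lowers `ξ` at `x` if `x` is a local maximum. -/
def lower (x : ℤ) (ξ : Interface) : Interface where
  toFun y := if y = x then max (ξ.toFun (x - 1)) (ξ.toFun (x + 1)) - 1 else ξ.toFun y
  step y := by
    have h1 := ξ.step y
    have h2 := ξ.step x
    have h3 := ξ.step (x - 1)
    rw [sub_add_cancel] at h3
    grind
  finite_ne := by
    refine (ξ.finite_ne.union (Set.finite_singleton x)).subset fun y hy => ?_
    by_cases h : y = x
    · exact Or.inr h
    · left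
      simpa [h] using hy

theorem raise_mono (x : ℤ) : Monotone (raise x) := by
  intro ξ η h y
  have h1 : ∀ z, ξ.toFun z ≤ η.toFun z := h
  have h2 := h1 (x - 1)
  have h3 := h1 (x + 1)
  have h4 := h1 y
  change (raise x ξ).toFun y ≤ (raise x η).toFun y
  simp only [raise]
  grind

theorem lower_mono (x : ℤ) : Monotone (lower x) := by
  intro ξ η h y
  have h1 : ∀ z, ξ.toFun z ≤ η.toFun z := h
  have h2 := h1 (x - 1)
  have h3 := h1 (x + 1)
  have h4 := h1 y
  change (lower x ξ).toFun y ≤ (lower x η).toFun y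
  simp only [lower]
  grind

theorem kill_mono (a : ℤ) (ha : |a| = 1) : Monotone (kill a ha) := by
  intro ξ η h y
  have h1 : ξ.toFun (y + a) ≤ η.toFun (y + a) := h (y + a)
  change (kill a ha ξ).toFun y ≤ (kill a ha η).toFun y
  simp only [kill, theta]
  grind

theorem kill_le (a : ℤ) (ha : |a| = 1) (ξ : Interface) : kill a ha ξ ≤ ξ := by
  intro y
  change (kill a ha ξ).toFun y ≤ ξ.toFun y
  have h1 := ξ.abs_le_toFun y
  have h2 := ξ.step y
  have h3 := ξ.step (y - 1)
  rw [sub_add_cancel] at h3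
  simp only [kill, theta, cone_zero]
  rcases (abs_eq zero_le_one).1 ha with rfl | rfl
  · grind
  · rw [← sub_eq_add_neg]
    grind

/-- A flip can swap a local minimum lying under a local maximum and so break the order. Here it is
realised by two monotone updates of which at least one acts trivially; at a slope all three do. -/
theorem flip_eq (ξ : Interface) (x : ℤ) :
    (raise x ξ = ξ.flip x ∧ lower x ξ = ξ) ∨ (raise x ξ = ξ ∧ lower x ξ = ξ.flip x) := by
  have h2 := ξ.step x
  have h3 := ξ.step (x - 1)
  rw [sub_add_cancel] at h3
  by_cases h : ξ.toFun (x - 1) = ξ.toFun x + 1 ∧ ξ.toFun (x + 1) = ξ.toFun x + 1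
  · left
    constructor
    · ext y
      simp only [raise, flip]
      split_ifs with hy
      · subst hy; grind
      · simp
    · ext y
      simp only [lower]
      split_ifs with hy
      · subst hy; grind
      · rfl
  · right
    constructor
    · ext y
      simp only [raise]
      split_ifs with hy
      · subst hy; grind
      · rfl
    · ext y
      simp only [lower, flip]
      split_ifs with hy
      · subst hy; grind
      · simp

theorem flip_sub_eq (f : Interface → ℝ) (ξ : Interface) (x : ℤ) :
    f (ξ.flip x) - f ξ = (f (raise x ξ) - f ξ) + (f (lower x ξ) - f ξ) := by
  rcases ξ.flip_eq x with ⟨h1, h2⟩ | ⟨h1, h2⟩ <;> rw [h1, h2] <;> ring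

theorem raise_lower_eq_self {ξ : Interface} {n : ℕ}
    (hn : ∀ x : ℤ, (n : ℤ) ≤ |x| → ξ.toFun x = |x|) {x : ℤ} (hx : (n : ℤ) < |x|) :
    raise x ξ = ξ ∧ lower x ξ = ξ := by
  have h1 := hn x hx.le
  have h2 := hn (x - 1) (by grind)
  have h3 := hn (x + 1) (by grind)
  constructor
  · ext y
    simp only [raise]
    split_ifs with hy
    · subst hy; grind
    · rfl
  · ext y
    simp only [lower]
    split_ifs with hy
    · subst hy; grind
    · rfl

theorem area_flip (ξ : Interface) (x : ℤ) :
    (ξ.flip x).area - ξ.area = ξ.toFun (x + 1) + ξ.toFun (x - 1) - 2 * ξ.toFun x := by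
  have h1 : ∀ y, (ξ.flip x).toFun y ≠ |y| → y ∈ insert x ξ.supp := by
    intro y hy
    by_cases h : y = x
    · simp [h]
    · refine Finset.mem_insert_of_mem ((ξ.mem_supp y).2 ?_)
      simpa [flip, h] using hy
  have h2 : ∀ y, ξ.toFun y ≠ |y| → y ∈ insert x ξ.supp := fun y hy =>
    Finset.mem_insert_of_mem ((ξ.mem_supp y).2 hy)
  rw [area_eq_sum _ h1, area_eq_sum _ h2, ← Finset.sum_sub_distrib]
  rw [Finset.sum_eq_single_of_mem x (Finset.mem_insert_self _ _)]
  · simp [flip]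
  · intro y _ hy
    simp [flip, hy]

theorem sum_Icc_sub (g : ℤ → ℤ) (n : ℕ) :
    ∑ x ∈ Finset.Icc (-(n : ℤ)) n, (g x - g (x - 1)) = g n - g (-n - 1) := by
  induction n with
  | zero => simp
  | succ n ih =>
    have h : Finset.Icc (-((n + 1 : ℕ) : ℤ)) (n + 1 : ℕ) =
        insert ((n : ℤ) + 1) (insert (-(n : ℤ) - 1) (Finset.Icc (-(n : ℤ)) n)) := by
      ext x
      simp only [Finset.mem_Icc, Finset.mem_insert]
      grind
    rw [h, Finset.sum_insert (by simp only [Finset.mem_Icc, Finset.mem_insert]; omega),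
      Finset.sum_insert (by simp only [Finset.mem_Icc]; omega), ih]
    push_cast
    rw [add_sub_cancel_right, show -(n + 1 : ℤ) - 1 = -n - 1 - 1 by ring]
    ring

/-- The Laplacians telescope to the difference of the outer slopes, `1 - (-1)`, whatever the
interface does in the middle. -/
theorem sum_area_flip {ξ : Interface} {n : ℕ}
    (hn : ∀ x : ℤ, (n : ℤ) ≤ |x| → ξ.toFun x = |x|) :
    ∑ x ∈ Finset.Icc (-(n : ℤ)) n, ((ξ.flip x).area - ξ.area) = 2 := by
  have h := sum_Icc_sub (fun x => ξ.toFun (x + 1) - ξ.toFun x) n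
  have h1 := hn n (by simp)
  have h2 := hn (n + 1) (by grind)
  have h3 := hn (-n) (by simp)
  have h4 := hn (-n - 1) (by grind)
  simp only [sub_add_cancel, h1, h2, h3, h4] at h
  calc _ = ∑ x ∈ Finset.Icc (-(n : ℤ)) n,
        (ξ.toFun (x + 1) - ξ.toFun x - (ξ.toFun x - ξ.toFun (x - 1))) :=
        Finset.sum_congr rfl fun x _ => by rw [area_flip]; ring
    _ = 2 := by rw [h]; grind

/-- The number of sites in the support of `ξ` from which a step in direction `-a` increases the
distance to the origin. -/
noncomputable def drop (a : ℤ) (ξ : Interface) : ℕ :=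
  (ξ.supp.filter fun y => |y - a| = |y| + 1).card

/-- The excess at `y` is carried to `y - a`. It is unchanged if that site is nearer the origin and
drops by 2 if it is farther. On the support the excess is positive and even, hence at least 2, so
the maximum with the cone never cuts into this drop. -/
theorem area_kill (a : ℤ) (ha : |a| = 1) (ξ : Interface) :
    (kill a ha ξ).area = ξ.area - 2 * drop a ξ := by
  have h1 : ∀ x, (kill a ha ξ).toFun x ≠ |x| →
      x ∈ ξ.supp.map (Equiv.subRight a).toEmbedding := by
    intro x hx
    rw [Finset.mem_map]
    refine ⟨x + a, (ξ.mem_supp _).2 fun h => hx ?_, by simp⟩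
    simp only [kill, theta, cone_zero, h]
    grind
  rw [area_eq_sum _ h1, Finset.sum_map, drop, Finset.card_filter, area]
  push_cast
  rw [Finset.mul_sum, ← Finset.sum_sub_distrib]
  refine Finset.sum_congr rfl fun y hy => ?_
  have h2 := ξ.abs_le_toFun y
  have h3 := ξ.excess_even y
  have h4 := (ξ.mem_supp y).1 hy
  simp only [kill, theta, cone_zero, Equiv.coe_toEmbedding, Equiv.subRight_apply, sub_add_cancel]
  grind

/-- From every site at least one of the two unit steps leads away from the origin; from `0` both do.
-/
theorem card_supp_le_drop_add_drop (ξ : Interface) :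
    ξ.supp.card ≤ drop (-1) ξ + drop 1 ξ := by
  rw [drop, drop]
  refine le_trans (Finset.card_le_card ?_) (Finset.card_union_le _ _)
  intro y hy
  simp only [Finset.mem_union, Finset.mem_filter, hy, true_and]
  grind

/-! ### The interface generator as a jump generator with the area as Lyapunov function. -/

/-- The elementary moves of the interface process. -/
def moves : ℤ ⊕ ℤ ⊕ Bool → Interface → Interface
  | .inl x => raise x
  | .inr (.inl x) => lower x
  | .inr (.inr false) => kill (-1) (by norm_num)
  | .inr (.inr true) => kill 1 (by norm_num)

/-- The rates of the elementary moves. -/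
noncomputable def rates (J : ℝ) : ℤ ⊕ ℤ ⊕ Bool → ℝ
  | .inl _ => 1 / 2
  | .inr (.inl _) => 1 / 2
  | .inr (.inr _) => J

theorem moves_mono (i : ℤ ⊕ ℤ ⊕ Bool) : Monotone (moves i) := by
  rcases i with x | x | (_ | _)
  exacts [raise_mono x, lower_mono x, kill_mono (-1) (by norm_num), kill_mono 1 (by norm_num)]

theorem rates_nonneg {J : ℝ} (hJ : 0 < J) (i : ℤ ⊕ ℤ ⊕ Bool) : 0 ≤ rates J i := by
  rcases i with x | x | b <;> simp [rates, hJ.le]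

/-- The indices of the moves which may act on an interface equal to the cone outside `(-n, n)`. -/
noncomputable def activeMoves (n : ℕ) : Finset (ℤ ⊕ ℤ ⊕ Bool) :=
  (Finset.Icc (-(n : ℤ)) n).disjSum ((Finset.Icc (-(n : ℤ)) n).disjSum Finset.univ)

theorem mem_activeMoves {ξ : Interface} {n : ℕ}
    (hn : ∀ x : ℤ, (n : ℤ) ≤ |x| → ξ.toFun x = |x|) (i : ℤ ⊕ ℤ ⊕ Bool) (hi : moves i ξ ≠ ξ) :
    i ∈ activeMoves n := by
  rcases i with x | x | b
  · simp only [activeMoves, Finset.inl_mem_disjSum, Finset.mem_Icc]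
    by_contra h
    exact hi (raise_lower_eq_self hn (x := x) (by grind)).1
  · simp only [activeMoves, Finset.inr_mem_disjSum, Finset.inl_mem_disjSum, Finset.mem_Icc]
    by_contra h
    exact hi (raise_lower_eq_self hn (x := x) (by grind)).2
  · simp [activeMoves]

theorem jumpGen_moves (J : ℝ) (f : Interface → ℝ) {ξ : Interface} {n : ℕ}
    (hn : ∀ x : ℤ, (n : ℤ) ≤ |x| → ξ.toFun x = |x|) :
    jumpGen moves (rates J) f ξ =
      1 / 2 * ∑ x ∈ Finset.Icc (-(n : ℤ)) n, (f (ξ.flip x) - f ξ) +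
      J * (f (ξ.kill (-1) (by norm_num)) - f ξ) + J * (f (ξ.kill 1 (by norm_num)) - f ξ) := by
  rw [jumpGen_eq_sum _ _ _ (mem_activeMoves hn), activeMoves, Finset.sum_disjSum,
    Finset.sum_disjSum]
  simp only [flip_sub_eq, Finset.sum_add_distrib, Finset.mul_sum, mul_add, rates, moves,
    Fintype.sum_bool]
  ring

theorem generator_eq_jumpGen (J : ℝ) (f : Interface → ℝ) (ξ : Interface) :
    generator J f ξ = jumpGen moves (rates J) f ξ := by
  obtain ⟨n, hn⟩ := ξ.exists_eq_abs
  rw [jumpGen_moves J f hn, generator, tsum_eq_sum]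
  intro x hx
  rw [Finset.mem_Icc] at hx
  have := raise_lower_eq_self hn (x := x) (by grind)
  rw [flip_sub_eq, this.1, this.2]
  simp

/-- Flips contribute `1 / 2 * 2` and the two kill moves `-2 * J` times their drops. The bound 1
alone gives the Lyapunov property; the negative support term gives tightness. -/
theorem jumpGen_area_le {J : ℝ} (hJ : 0 < J) (ξ : Interface) :
    jumpGen moves (rates J) (fun η => (η.area : ℝ)) ξ ≤ 1 - 2 * J * ξ.supp.card := by
  obtain ⟨n, hn⟩ := ξ.exists_eq_abs
  have h1 := sum_area_flip hn
  have h2 : (ξ.supp.card : ℝ) ≤ drop (-1) ξ + drop 1 ξ := by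
    exact_mod_cast ξ.card_supp_le_drop_add_drop
  rw [jumpGen_moves J _ hn]
  have h3 : ∑ x ∈ Finset.Icc (-(n : ℤ)) n, (((ξ.flip x).area : ℝ) - ξ.area) = 2 := by
    exact_mod_cast h1
  rw [h3, area_kill, area_kill]
  push_cast
  nlinarith

theorem isLyapunov_area {J : ℝ} (hJ : 0 < J) :
    IsLyapunov moves (rates J) (fun η => (η.area : ℝ)) 1 where
  rate_nonneg := rates_nonneg hJ
  finite_moves ξ := by
    obtain ⟨n, hn⟩ := ξ.exists_eq_abs
    exact (activeMoves n).finite_toSet.subset fun i hi => mem_activeMoves hn i hi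
  nonneg ξ := by exact_mod_cast ξ.area_nonneg
  finite_sublevel a := by
    refine (finite_card_supp_le ⌊a⌋₊).subset fun ξ hξ => Nat.le_floor ?_
    have h1 : ((ξ.supp.card : ℤ) : ℝ) ≤ ξ.area := by exact_mod_cast ξ.card_supp_le_area
    exact (by exact_mod_cast h1 : (ξ.supp.card : ℝ) ≤ ξ.area).trans hξ
  const_nonneg := zero_le_one
  drift ξ := (jumpGen_area_le hJ ξ).trans (by
    have : 0 ≤ 2 * J * (ξ.supp.card : ℝ) := by positivity
    linarith)

instance : Countable Interface := by
  have : (Set.univ : Set Interface) = ⋃ n : ℕ, {ξ : Interface | ξ.supp.card ≤ n} := by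
    ext ξ
    simp only [Set.mem_univ, Set.mem_iUnion, true_iff]
    exact ⟨ξ.supp.card, le_refl ξ.supp.card⟩
  rw [← Set.countable_univ_iff, this]
  exact Set.countable_iUnion fun n => (finite_card_supp_le n).countable

theorem exists_kill_area_lt {ξ : Interface} (h : ξ ≠ coneO) :
    ∃ b : Bool, (moves (.inr (.inr b)) ξ).area < ξ.area := by
  have h1 : ξ.supp.card ≠ 0 := fun h0 => h (eq_coneO_of_card_supp_eq_zero h0)
  have h2 := ξ.card_supp_le_drop_add_drop
  by_cases h3 : drop 1 ξ = 0
  · refine ⟨false, ?_⟩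
    rw [moves, area_kill]
    omega
  · refine ⟨true, ?_⟩
    rw [moves, area_kill]
    omega

end Interface

/-! ### Attractivity and comparison of rates. -/

section Coupling

variable {S ι : Type*} [Preorder S] {φ : ι → S → S} {r : ι → ℝ} {V : S → ℝ} {c : ℝ}

/-- The moves `φ`, performed simultaneously in both components of an ordered pair. -/
def pairMoves (hφ : ∀ i, Monotone (φ i)) (i : ι) (p : {p : S × S // p.1 ≤ p.2}) :
    {p : S × S // p.1 ≤ p.2} :=
  ⟨(φ i p.1.1, φ i p.1.2), hφ i p.2⟩

theorem pairMoves_eq_self (hφ : ∀ i, Monotone (φ i)) {i : ι} {p : {p : S × S // p.1 ≤ p.2}}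
    (h1 : φ i p.1.1 = p.1.1) (h2 : φ i p.1.2 = p.1.2) : pairMoves hφ i p = p :=
  Subtype.ext (Prod.ext h1 h2)

theorem IsLyapunov.jumpGen_pairMoves (h : IsLyapunov φ r V c) (hφ : ∀ i, Monotone (φ i))
    (f g : S → ℝ) (p : {p : S × S // p.1 ≤ p.2}) :
    jumpGen (pairMoves hφ) r (fun q => f q.1.1 + g q.1.2) p =
      jumpGen φ r f p.1.1 + jumpGen φ r g p.1.2 := by
  classical
  set s := (h.finite_moves p.1.1).toFinset ∪ (h.finite_moves p.1.2).toFinset with hs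
  rw [jumpGen_eq_sum φ r f (s := s) fun i hi =>
      Finset.mem_union_left _ (h.moves_mem _ i hi),
    jumpGen_eq_sum φ r g (s := s) fun i hi =>
      Finset.mem_union_right _ (h.moves_mem _ i hi),
    jumpGen_eq_sum (pairMoves hφ) r _ (s := s), ← Finset.sum_add_distrib]
  · exact Finset.sum_congr rfl fun i _ => by simp only [pairMoves]; ring
  · intro i hi
    by_contra h'
    simp only [hs, Finset.mem_union, Set.Finite.mem_toFinset, Set.mem_ofPred_eq, not_or,
      not_not] at h'
    exact hi (pairMoves_eq_self hφ h'.1 h'.2)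

theorem IsLyapunov.pair (h : IsLyapunov φ r V c) (hφ : ∀ i, Monotone (φ i)) :
    IsLyapunov (pairMoves hφ) r (fun p => V p.1.1 + V p.1.2) (c + c) where
  rate_nonneg := h.rate_nonneg
  finite_moves p := by
    refine ((h.finite_moves p.1.1).union (h.finite_moves p.1.2)).subset fun i hi => ?_
    by_contra h'
    simp only [Set.mem_union, Set.mem_ofPred_eq, not_or, not_not] at h'
    exact hi (pairMoves_eq_self hφ h'.1 h'.2)
  nonneg p := add_nonneg (h.nonneg _) (h.nonneg _)
  finite_sublevel a := by
    refine Set.Finite.of_finite_image (f := Subtype.val)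
      (((h.finite_sublevel a).prod (h.finite_sublevel a)).subset ?_)
      Subtype.val_injective.injOn
    rintro _ ⟨p, hp, rfl⟩
    have h1 := h.nonneg p.1.1
    have h2 := h.nonneg p.1.2
    have h3 : V p.1.1 + V p.1.2 ≤ a := hp
    exact ⟨show V p.1.1 ≤ a by linarith, show V p.1.2 ≤ a by linarith⟩
  const_nonneg := add_nonneg h.const_nonneg h.const_nonneg
  drift p := by
    rw [h.jumpGen_pairMoves hφ]
    exact add_le_add (h.drift _) (h.drift _)

/-- If the moves are monotone, the backward equation preserves monotonicity. -/
theorem IsSolution.monotone (h : IsLyapunov φ r V c) (hφ : ∀ i, Monotone (φ i)) {f : S → ℝ}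
    {u : ℝ → S → ℝ} (hu : IsSolution φ r f u) (hf : Monotone f) {t : ℝ} (ht : 0 ≤ t) :
    Monotone (u t) := by
  intro ξ η hξη
  -- The basic coupling without probability: the difference of `u` at the lower and the upper
  -- component solves the backward equation on ordered pairs and starts nonpositive.
  have h' := (h.pair hφ).nonpos_of_subsolution
    (u := fun s p => u s p.1.1 + -1 * u s p.1.2)
    (u' := fun s p => jumpGen φ r (u s) p.1.1 + -1 * jumpGen φ r (u s) p.1.2)
    ?_ ?_ ?_ ?_ ht ⟨(ξ, η), hξη⟩
  · simp only at h'
    linarith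
  · intro T
    obtain ⟨C, hC⟩ := hu.locally_bdd T
    exact ⟨C + C, fun t ht p => by
      linarith [(_root_.abs_le.1 (hC t ht p.1.1)).2, (_root_.abs_le.1 (hC t ht p.1.2)).1]⟩
  · intro p
    rw [hu.init]
    linarith [hf p.2]
  · exact fun s hs p => (hu.deriv s hs _).add ((hu.deriv s hs _).const_mul (-1))
  · intro s _ p _
    rw [h.jumpGen_pairMoves hφ (u s) (fun ζ => -1 * u s ζ), h.jumpGen_mul]

/-- Increasing the rates of decreasing moves decreases the solution with monotone initial value. -/
theorem IsSolution.le_of_rates_le {r' : ι → ℝ} {V' : S → ℝ} {c' : ℝ} (h : IsLyapunov φ r V c)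
    (h' : IsLyapunov φ r' V' c') (hφ : ∀ i, Monotone (φ i))
    (hr : ∀ i, r i = r' i ∨ r' i ≤ r i ∧ ∀ ξ, φ i ξ ≤ ξ) {f : S → ℝ} (hf : Monotone f)
    {u v : ℝ → S → ℝ} (hu : IsSolution φ r f u) (hv : IsSolution φ r' f v) {t : ℝ}
    (ht : 0 ≤ t) (ξ : S) : u t ξ ≤ v t ξ := by
  refine sub_nonpos.1 (h.nonpos_of_subsolution (u := fun s η => u s η - v s η)
    (u' := fun s η => jumpGen φ r (u s) η - jumpGen φ r' (v s) η) ?_ ?_ ?_ ?_ ht ξ)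
  · intro T
    obtain ⟨C, hC⟩ := hu.locally_bdd T
    obtain ⟨D, hD⟩ := hv.locally_bdd T
    exact ⟨C + D, fun t ht ξ => by
      linarith [(_root_.abs_le.1 (hC t ht ξ)).2, (_root_.abs_le.1 (hD t ht ξ)).1]⟩
  · intro η
    simp [hu.init, hv.init]
  · exact fun s hs η => (hu.deriv s hs η).sub (hv.deriv s hs η)
  · intro s hs η _
    rw [h.jumpGen_sub]
    refine sub_le_sub_left ?_ _
    rw [h.jumpGen_eq, jumpGen_eq_sum φ r' _ (h.moves_mem η)]
    refine Finset.sum_le_sum fun i _ => ?_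
    rcases hr i with hi | ⟨hi, hφi⟩
    · rw [hi]
    -- The solution `v` stays monotone, so a decreasing move gives a nonpositive increment, and a
    -- larger rate makes its contribution smaller.
    · exact mul_le_mul_of_nonpos_right hi
        (sub_nonpos.2 (hv.monotone h' hφ hf hs (hφi η)))

end Coupling

/-! ### Strict positivity and time integrals of solutions. -/

section Positivity

variable {S ι : Type*} {φ : ι → S → S} {r : ι → ℝ} {V : S → ℝ} {c : ℝ}

namespace IsSolution

/-- The integrating factor with the exit rate at `ξ` cancels the diagonal term, so for a nonnegative
solution only nonnegative incoming terms remain. -/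
theorem hasDerivWithinAt_exp_mul (h : IsLyapunov φ r V c) {f : S → ℝ} {u : ℝ → S → ℝ}
    (hu : IsSolution φ r f u) (ξ : S) {t : ℝ} (ht : 0 ≤ t) :
    HasDerivWithinAt
      (fun s => Real.exp ((∑ i ∈ (h.finite_moves ξ).toFinset, r i) * s) * u s ξ)
      (Real.exp ((∑ i ∈ (h.finite_moves ξ).toFinset, r i) * t) *
        ∑ i ∈ (h.finite_moves ξ).toFinset, r i * u t (φ i ξ)) (Set.Ici 0) t := by
  set q := ∑ i ∈ (h.finite_moves ξ).toFinset, r i with hq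
  have h1 : HasDerivAt (fun s => Real.exp (q * s)) (Real.exp (q * t) * (q * 1)) t :=
    ((hasDerivAt_id t).const_mul q).exp
  refine (h1.hasDerivWithinAt.mul (hu.deriv t ht ξ)).congr_deriv ?_
  rw [h.jumpGen_eq]
  simp only [mul_sub, Finset.sum_sub_distrib, ← Finset.sum_mul, ← hq]
  ring

theorem monotoneOn_exp_mul (h : IsLyapunov φ r V c) {f : S → ℝ} {u : ℝ → S → ℝ}
    (hu : IsSolution φ r f u) (hf : ∀ ξ, 0 ≤ f ξ) (ξ : S) :
    MonotoneOn (fun s => Real.exp ((∑ i ∈ (h.finite_moves ξ).toFinset, r i) * s) * u s ξ)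
      (Set.Ici 0) := by
  have hpos : ∀ s, 0 ≤ s → ∀ η, 0 ≤ u s η := fun s hs η =>
    (isSolution_const 0).mono h hu hf hs η
  refine monotoneOn_of_hasDerivWithinAt_nonneg (convex_Ici 0)
    (fun s hs => (hu.hasDerivWithinAt_exp_mul h ξ hs).continuousWithinAt)
    (fun s hs => (hu.hasDerivWithinAt_exp_mul h ξ (interior_subset hs)).mono interior_subset)
    fun s hs => ?_
  exact mul_nonneg (Real.exp_pos _).le (Finset.sum_nonneg fun i _ =>
    mul_nonneg (h.rate_nonneg i) (hpos s (interior_subset hs) _))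

theorem pos_of_init_pos (h : IsLyapunov φ r V c) {f : S → ℝ} {u : ℝ → S → ℝ}
    (hu : IsSolution φ r f u) (hf : ∀ ξ, 0 ≤ f ξ) {ξ : S} (hξ : 0 < f ξ) {t : ℝ} (ht : 0 ≤ t) :
    0 < u t ξ := by
  have := hu.monotoneOn_exp_mul h hf ξ Set.self_mem_Ici ht ht
  simp only [mul_zero, Real.exp_zero, one_mul, hu.init] at this
  exact pos_of_mul_pos_right (hξ.trans_le this) (Real.exp_pos _).le

theorem pos_of_move (h : IsLyapunov φ r V c) {f : S → ℝ} {u : ℝ → S → ℝ}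
    (hu : IsSolution φ r f u) (hf : ∀ ξ, 0 ≤ f ξ) {ξ : S} {i : ι} (hi : 0 < r i)
    (hφ : ∀ t, 0 < t → 0 < u t (φ i ξ)) {t : ℝ} (ht : 0 < t) : 0 < u t ξ := by
  by_cases hne : φ i ξ = ξ
  · simpa [hne] using hφ t ht
  have hpos : ∀ s, 0 ≤ s → ∀ η, 0 ≤ u s η := fun s hs η =>
    (isSolution_const 0).mono h hu hf hs η
  have hmono := strictMonoOn_of_hasDerivWithinAt_pos (convex_Ici 0)
    (fun s hs => (hu.hasDerivWithinAt_exp_mul h ξ hs).continuousWithinAt)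
    (fun s hs => (hu.hasDerivWithinAt_exp_mul h ξ (interior_subset hs)).mono interior_subset)
    fun s hs => ?_
  · have := hmono Set.self_mem_Ici ht.le ht
    simp only [mul_zero, Real.exp_zero, one_mul] at this
    exact pos_of_mul_pos_right ((hpos 0 le_rfl ξ).trans_lt this) (Real.exp_pos _).le
  · have hs0 : 0 < s := by simpa using hs
    refine mul_pos (Real.exp_pos _) (Finset.sum_pos' (fun j _ =>
      mul_nonneg (h.rate_nonneg j) (hpos s hs0.le _)) ⟨i, h.moves_mem ξ i hne, ?_⟩)
    exact mul_pos hi (hφ s hs0)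

/-- The generator is a finite sum at `ξ`, so it commutes with the time integral; the fundamental
theorem of calculus does the rest. -/
theorem jumpGen_integral (h : IsLyapunov φ r V c) {f : S → ℝ} {u : ℝ → S → ℝ}
    (hu : IsSolution φ r f u) {t : ℝ} (ht : 0 ≤ t) (ξ : S) :
    jumpGen φ r (fun η => ∫ s in (0 : ℝ)..t, u s η) ξ = u t ξ - f ξ := by
  have hint : ∀ η, IntervalIntegrable (fun s => u s η) volume 0 t := fun η =>
    ((hu.continuousOn η).mono (by rw [Set.uIcc_of_le ht]; exact Set.Icc_subset_Ici_self)
      ).intervalIntegrable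
  have hftc := intervalIntegral.integral_eq_sub_of_hasDeriv_right_of_le ht
    ((hu.continuousOn ξ).mono Set.Icc_subset_Ici_self)
    (f' := fun s => jumpGen φ r (u s) ξ)
    (fun s hs => (hu.deriv s hs.1.le ξ).mono fun x hx => hs.1.le.trans (le_of_lt hx)) (by
      simp only [h.jumpGen_eq]
      have := IntervalIntegrable.sum (h.finite_moves ξ).toFinset
        (f := fun i s => r i * (u s (φ i ξ) - u s ξ))
        fun i _ => ((hint (φ i ξ)).sub (hint ξ)).const_mul (r i)
      rwa [Finset.sum_fn] at this)
  rw [← congrFun hu.init ξ, ← hftc, h.jumpGen_eq]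
  simp only [h.jumpGen_eq]
  rw [intervalIntegral.integral_finsetSum fun i _ => ((hint _).sub (hint ξ)).const_mul _]
  refine Finset.sum_congr rfl fun i _ => ?_
  rw [intervalIntegral.integral_const_mul, intervalIntegral.integral_sub (hint _) (hint ξ)]

/-- If `L V ≤ c - f`, the time integral of the solution with initial value `f` is bounded by the
Lyapunov function. -/
theorem integral_le (h : IsLyapunov φ r V c) {f : S → ℝ} {u : ℝ → S → ℝ}
    (hu : IsSolution φ r f u) (hcont : ∀ ξ, Continuous fun t => u t ξ) {C : ℝ}
    (hf : ∀ ξ, |f ξ| ≤ C) (hV : ∀ ξ, jumpGen φ r V ξ ≤ c - f ξ) {t : ℝ} (ht : 0 ≤ t) (ξ : S) :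
    ∫ s in (0 : ℝ)..t, u s ξ ≤ V ξ + c * t := by
  refine sub_nonpos.1 (h.nonpos_of_subsolution
    (u := fun t η => (∫ s in (0 : ℝ)..t, u s η) - (V η + c * t))
    (u' := fun t η => u t η - c * 1) ?_ ?_ ?_ ?_ ht ξ)
  · refine fun T => ⟨C * T, fun t ht η => ?_⟩
    have h1 : ‖∫ s in (0 : ℝ)..t, u s η‖ ≤ C * |t - 0| := by
      refine intervalIntegral.norm_integral_le_of_norm_le_const fun s hs => ?_
      rw [Set.uIoc_of_le ht.1] at hs
      exact hu.abs_le h hf hs.1.le η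
    rw [sub_zero, abs_of_nonneg ht.1, Real.norm_eq_abs] at h1
    have h2 := mul_le_mul_of_nonneg_left ht.2 ((abs_nonneg _).trans (hf η))
    have h3 := mul_nonneg h.const_nonneg ht.1
    have h4 := h.nonneg η
    linarith [le_abs_self (∫ s in (0 : ℝ)..t, u s η)]
  · intro η
    simpa using h.nonneg η
  · intro t ht η
    have h1 : HasDerivAt (fun t => ∫ s in (0 : ℝ)..t, u s η) (u t η) t :=
      intervalIntegral.integral_hasDerivAt_right ((hcont η).intervalIntegrable _ _)
        ((hcont η).stronglyMeasurableAtFilter _ _) (hcont η).continuousAt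
    exact (h1.sub (((hasDerivAt_id t).const_mul c).const_add (V η))).hasDerivWithinAt
  · intro t ht η _
    have := hV η
    rw [h.jumpGen_sub, hu.jumpGen_integral h ht, h.jumpGen_add_const]
    linarith

end IsSolution

end Positivity

/-! ### Uniqueness of invariant laws for a kernel that reaches a fixed state. -/

section Invariance

variable {S : Type*} [MeasurableSpace S] [DiscreteMeasurableSpace S] [Countable S]

theorem Bdd.hasSum_integral {f : S → ℝ} (hf : Bdd f) (μ : Measure S) [IsFiniteMeasure μ] :
    HasSum (fun ξ => μ.real {ξ} * f ξ) (∫ ξ, f ξ ∂μ) := by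
  have := hasSum_integral_iUnion (μ := μ) (f := f) (s := fun ξ : S => {ξ})
    (fun ξ => MeasurableSet.singleton ξ)
    (fun ξ η h => Set.disjoint_singleton.2 h) (hf.integrable μ).integrableOn
  rw [Set.iUnion_of_singleton, setIntegral_univ] at this
  simpa only [integral_singleton, smul_eq_mul] using this

/-- Let `D` be the set where `μ` has more mass than `ν`. By invariance the sum of `(μ - ν) * (1_D -
κ 1_D)` is zero, yet each term is nonnegative. So from `ξ` in `D` the kernel stays in `D` almost
surely, which is impossible if `o`, charged from everywhere, lies outside `D`. -/
theorem exists_lt_singleton_of_invariant {κ : Kernel S S} [IsMarkovKernel κ] {o : S}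
    (ho : ∀ ξ, 0 < (κ ξ).real {o}) {μ ν : Measure S} [IsProbabilityMeasure μ]
    [IsProbabilityMeasure ν] (hμ : κ.Invariant μ) (hν : κ.Invariant ν) {ξ : S}
    (hξ : ν.real {ξ} < μ.real {ξ}) : ν.real {o} < μ.real {o} := by
  classical
  by_contra! hle
  set D : Set S := {η | ν.real {η} < μ.real {η}} with hD
  set f : S → ℝ := D.indicator fun _ => 1 with hf
  set g : S → ℝ := fun η => ∫ ζ, f ζ ∂κ η with hg
  have hfb : Bdd f := bdd_indicator D
  have hgb : Bdd g := hfb.kernel_integral κ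
  have hgD : ∀ η, g η = (κ η).real D := fun η => by
    rw [hg, hf]
    simp only
    rw [integral_indicator_const _ (MeasurableSet.of_discrete), smul_eq_mul, mul_one]
  have hint : ∀ ρ : Measure S, IsProbabilityMeasure ρ → κ.Invariant ρ →
      ∫ η, (f - g) η ∂ρ = 0 := by
    intro ρ _ hρ
    have h1 := hfb.integral_bind ρ κ
    rw [hρ.def] at h1
    simp only [Pi.sub_apply]
    rw [integral_sub (hfb.integrable ρ) (hgb.integrable ρ), h1, sub_self]
  have hsum : HasSum (fun η => (μ.real {η} - ν.real {η}) * (f - g) η) 0 := by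
    have h1 := (hfb.sub hgb).hasSum_integral μ
    have h2 := (hfb.sub hgb).hasSum_integral ν
    rw [hint μ inferInstance hμ] at h1
    rw [hint ν inferInstance hν] at h2
    simpa [sub_mul] using h1.sub h2
  have hnn : ∀ η, 0 ≤ (μ.real {η} - ν.real {η}) * (f - g) η := by
    intro η
    have h0 : 0 ≤ g η := by rw [hgD]; exact measureReal_nonneg
    have h1 : g η ≤ 1 := by rw [hgD]; exact measureReal_le_one
    by_cases hη : η ∈ D
    · have h2 : f η = 1 := by simp [hf, hη]
      have h3 : ν.real {η} < μ.real {η} := hη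
      exact mul_nonneg (by linarith) (by rw [Pi.sub_apply]; linarith)
    · have h2 : f η = 0 := by simp [hf, hη]
      have h3 : μ.real {η} ≤ ν.real {η} := not_lt.1 hη
      exact mul_nonneg_of_nonpos_of_nonpos (by linarith) (by rw [Pi.sub_apply]; linarith)
  have hzero := congrFun ((hasSum_zero_iff_of_nonneg hnn).1 hsum) ξ
  have hξD : ξ ∈ D := hξ
  have hfξ : f ξ = 1 := by simp [hf, hξD]
  have hoD : o ∉ D := not_lt.2 hle
  have h1 : (κ ξ).real D + (κ ξ).real {o} ≤ 1 := by
    rw [← measureReal_union (Set.disjoint_singleton_right.2 hoD) (MeasurableSet.singleton o)]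
    exact measureReal_le_one
  have h2 := ho ξ
  have h3 : 0 < (μ.real {ξ} - ν.real {ξ}) * (f - g) ξ :=
    mul_pos (by linarith) (by rw [Pi.sub_apply, hfξ, hgD]; linarith)
  exact h3.ne' hzero

/-- A Markov kernel which reaches a fixed state from everywhere has at most one invariant
law. -/
theorem invariant_unique {κ : Kernel S S} [IsMarkovKernel κ] {o : S}
    (ho : ∀ ξ, 0 < (κ ξ).real {o}) {μ ν : Measure S} [IsProbabilityMeasure μ]
    [IsProbabilityMeasure ν] (hμ : κ.Invariant μ) (hν : κ.Invariant ν) : μ = ν := by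
  have key : ∀ μ ν : Measure S, IsProbabilityMeasure μ → IsProbabilityMeasure ν →
      (∀ ξ, μ.real {ξ} ≤ ν.real {ξ}) → μ = ν := by
    intro μ ν _ _ h
    refine Measure.eq_of_le_of_isProbabilityMeasure (Measure.le_iff.2 fun A _ => ?_)
    rw [← Measure.tsum_indicator_apply_singleton μ A MeasurableSet.of_discrete,
      ← Measure.tsum_indicator_apply_singleton ν A MeasurableSet.of_discrete]
    refine ENNReal.tsum_le_tsum fun ξ => Set.indicator_le_indicator ?_
    exact (ENNReal.toReal_le_toReal (measure_ne_top _ _) (measure_ne_top _ _)).1 (h ξ)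
  -- The law with no more mass at `o` is dominated at every point, and ordered probability measures
  -- are equal.
  rcases le_total (μ.real {o}) (ν.real {o}) with h | h
  · exact key μ ν inferInstance inferInstance fun ξ => not_lt.1 fun hlt =>
      not_lt.2 h (exists_lt_singleton_of_invariant ho hμ hν hlt)
  · exact (key ν μ inferInstance inferInstance fun ξ => not_lt.1 fun hlt =>
      not_lt.2 h (exists_lt_singleton_of_invariant ho hν hμ hlt)).symm

end Invariance

/-! ### The interface semigroup: uniqueness, order and reachability of the cone. -/

open Interface

/-- Clamping to `[-n, n]` preserves monotonicity, and dominated convergence recovers the integrable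
function. -/
theorem stochLE_of_bdd {μ ν : ProbabilityMeasure Interface}
    (h : ∀ f : Interface → ℝ, Monotone f → Bdd f →
      ∫ ξ, f ξ ∂(μ : Measure Interface) ≤ ∫ ξ, f ξ ∂(ν : Measure Interface)) :
    StochLE μ ν := by
  intro f hf hμ hν
  set F : ℕ → Interface → ℝ := fun n ξ => max (min (f ξ) n) (-n) with hF
  have hle : ∀ n ξ, ‖F n ξ‖ ≤ ‖f ξ‖ := by
    intro n ξ
    have : (0 : ℝ) ≤ n := n.cast_nonneg
    simp only [hF, Real.norm_eq_abs]
    grind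
  have hlim : ∀ ξ, Tendsto (fun n => F n ξ) atTop (𝓝 (f ξ)) := by
    intro ξ
    refine tendsto_const_nhds.congr' ?_
    filter_upwards [eventually_ge_atTop ⌈|f ξ|⌉₊] with n hn
    have := Nat.ceil_le.1 hn
    simp only [hF]
    grind
  have hconv : ∀ ρ : ProbabilityMeasure Interface, Integrable f (ρ : Measure Interface) →
      Tendsto (fun n => ∫ ξ, F n ξ ∂(ρ : Measure Interface)) atTop
        (𝓝 (∫ ξ, f ξ ∂(ρ : Measure Interface))) := fun ρ hρ =>
    tendsto_integral_of_dominated_convergence (fun ξ => ‖f ξ‖)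
      (fun n => Measurable.of_discrete.aestronglyMeasurable) hρ.norm
      (fun n => Eventually.of_forall (hle n)) (Eventually.of_forall hlim)
  refine le_of_tendsto_of_tendsto' (hconv μ hμ) (hconv ν hν) fun n => h _ ?_ ⟨n, fun ξ => ?_⟩
  · intro ξ η hξη
    have := hf hξη
    simp only [hF]
    grind
  · have : (0 : ℝ) ≤ n := n.cast_nonneg
    simp only [hF]
    grind

theorem IsInterfaceSemigroup.isSolution {J : ℝ} {P : ℝ≥0 → Kernel Interface Interface}
    (hP : IsInterfaceSemigroup J P) {f : Interface → ℝ} (hf : Bdd f) :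
    IsSolution moves (rates J) f fun t ξ => ∫ η, f η ∂(P t.toNNReal ξ) where
  init := by
    ext ξ
    rw [Real.toNNReal_zero, hP.zero, Kernel.id_apply, integral_dirac]
  locally_bdd T := by
    obtain ⟨C, hC⟩ := hf
    refine ⟨C, fun t _ ξ => ?_⟩
    have := hP.markov t.toNNReal
    simpa using norm_integral_le_of_norm_le_const (μ := P t.toNNReal ξ)
      (Eventually.of_forall fun η => (Real.norm_eq_abs (f η)).trans_le (hC η))
  deriv t ht ξ := by
    have := hP.kolmogorov f hf ξ t.toNNReal
    rwa [generator_eq_jumpGen, Real.coe_toNNReal t ht] at this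

namespace IsInterfaceSemigroup

variable {J : ℝ} {P : ℝ≥0 → Kernel Interface Interface}


theorem eq (hJ : 0 < J) {Q : ℝ≥0 → Kernel Interface Interface}
    (hP : IsInterfaceSemigroup J P) (hQ : IsInterfaceSemigroup J Q) : P = Q := by
  ext1 t
  ext1 ξ
  have := hP.markov t
  have := hQ.markov t
  refine measure_ext_of_forall_integral fun f hf => ?_
  simpa using (hP.isSolution hf).unique (isLyapunov_area hJ) (hQ.isSolution hf) t.coe_nonneg ξ

theorem monotone_integral (hJ : 0 < J) (hP : IsInterfaceSemigroup J P) {f : Interface → ℝ}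
    (hm : Monotone f) (hf : Bdd f) (t : ℝ≥0) : Monotone fun ξ => ∫ η, f η ∂(P t ξ) := by
  simpa using (hP.isSolution hf).monotone (isLyapunov_area hJ) moves_mono hm t.coe_nonneg

theorem integral_add (hP : IsInterfaceSemigroup J P) {f : Interface → ℝ} (hf : Bdd f)
    (s t : ℝ≥0) (ξ : Interface) :
    ∫ η, f η ∂(P (s + t) ξ) = ∫ ζ, ∫ η, f η ∂(P t ζ) ∂(P s ξ) := by
  have := hP.markov s
  have := hP.markov t
  rw [hP.add, Kernel.integral_comp (hf.integrable _)]

/-- Whatever the state after time `a`, it lies above the cone; running for a further time `s` keeps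
this order by attractivity. -/
theorem integral_coneO_mono (hJ : 0 < J) (hP : IsInterfaceSemigroup J P) {f : Interface → ℝ}
    (hm : Monotone f) (hf : Bdd f) : Monotone fun t => ∫ η, f η ∂(P t coneO) := by
  intro s t hst
  obtain ⟨a, rfl⟩ := exists_add_of_le hst
  have := hP.markov s
  have := hP.markov a
  have h1 : ∫ _, (∫ η, f η ∂(P s coneO)) ∂(P a coneO) = ∫ η, f η ∂(P s coneO) := by simp
  simp only
  rw [add_comm s a, hP.integral_add hf, ← h1]
  exact integral_mono ((bdd_const _).integrable _) ((hf.kernel_integral (P s)).integrable _)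
    fun ξ => hP.monotone_integral hJ hm hf s ξ.coneO_le

theorem integral_lawAt (hP : IsInterfaceSemigroup J P) {f : Interface → ℝ} (hf : Bdd f)
    (ν : ProbabilityMeasure Interface) (t : ℝ≥0) :
    ∫ η, f η ∂(lawAt hP ν t : Measure Interface) =
      ∫ ξ, ∫ η, f η ∂(P t ξ) ∂(ν : Measure Interface) := by
  have := hP.markov t
  exact hf.integral_bind (ν : Measure Interface) (P t)

theorem integral_lawAt_startCone (hP : IsInterfaceSemigroup J P) {f : Interface → ℝ}
    (hf : Bdd f) (t : ℝ≥0) :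
    ∫ η, f η ∂(lawAt hP startCone t : Measure Interface) = ∫ η, f η ∂(P t coneO) := by
  rw [hP.integral_lawAt hf]
  exact integral_dirac _ _

theorem attractive (hJ : 0 < J) (hP : IsInterfaceSemigroup J P) : Attractive hP := by
  intro ν₁ ν₂ h t
  have := hP.markov t
  refine stochLE_of_bdd fun f hm hf => ?_
  rw [hP.integral_lawAt hf, hP.integral_lawAt hf]
  exact h _ (hP.monotone_integral hJ hm hf t) ((hf.kernel_integral _).integrable _)
    ((hf.kernel_integral _).integrable _)

theorem stochLE_lawAt_startCone (hJ : 0 < J) (hP : IsInterfaceSemigroup J P) {s t : ℝ≥0}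
    (hst : s ≤ t) : StochLE (lawAt hP startCone s) (lawAt hP startCone t) := by
  refine stochLE_of_bdd fun f hm hf => ?_
  rw [hP.integral_lawAt_startCone hf, hP.integral_lawAt_startCone hf]
  exact hP.integral_coneO_mono hJ hm hf hst

theorem integral_invariant (hP : IsInterfaceSemigroup J P) {μ : ProbabilityMeasure Interface}
    (hμ : IsInvariantLaw P μ) {f : Interface → ℝ} (hf : Bdd f) (t : ℝ≥0) :
    ∫ ξ, ∫ η, f η ∂(P t ξ) ∂(μ : Measure Interface) = ∫ η, f η ∂(μ : Measure Interface) := by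
  have := hP.markov t
  rw [← hf.integral_bind (μ : Measure Interface) (P t), (hμ t).def]

theorem stochLE_invariant (hJ : 0 < J) (hP : IsInterfaceSemigroup J P)
    {μ : ProbabilityMeasure Interface} (hμ : IsInvariantLaw P μ) (t : ℝ≥0) :
    StochLE (lawAt hP startCone t) μ := by
  refine stochLE_of_bdd fun f hm hf => ?_
  have := hP.markov t
  have h1 : ∫ _, (∫ η, f η ∂(P t coneO)) ∂(μ : Measure Interface) = ∫ η, f η ∂(P t coneO) := by
    simp
  rw [hP.integral_lawAt_startCone hf, ← hP.integral_invariant hμ hf t, ← h1]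
  exact integral_mono ((bdd_const _).integrable _) ((hf.kernel_integral (P t)).integrable _)
    fun ξ => hP.monotone_integral hJ hm hf t ξ.coneO_le

/-- Induction on the area: away from the cone some kill move has positive rate and strictly lowers
the area, and positivity propagates back along it. -/
theorem pos_coneO (hJ : 0 < J) (hP : IsInterfaceSemigroup J P) {t : ℝ≥0} (ht : 0 < t)
    (ξ : Interface) : 0 < (P t ξ).real {coneO} := by
  set f : Interface → ℝ := ({coneO} : Set Interface).indicator fun _ => 1 with hf
  have hu := hP.isSolution (bdd_indicator ({coneO} : Set Interface))
  have hL := isLyapunov_area hJ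
  have hf0 : ∀ ξ, 0 ≤ f ξ := fun ξ => Set.indicator_nonneg (fun _ _ => zero_le_one) ξ
  have key : ∀ n : ℕ, ∀ ξ : Interface, ξ.area.toNat = n → ∀ t : ℝ, 0 < t →
      0 < ∫ η, f η ∂(P t.toNNReal ξ) := by
    intro n
    induction n using Nat.strong_induction_on with
    | _ n ih =>
      intro ξ hξ t ht
      by_cases h0 : ξ = coneO
      · exact hu.pos_of_init_pos hL hf0 (by simp [h0]) ht.le
      · obtain ⟨b, hb⟩ := exists_kill_area_lt h0
        have h1 := (moves (.inr (.inr b)) ξ).area_nonneg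
        exact hu.pos_of_move hL hf0 (i := .inr (.inr b)) hJ
          (fun s hs => ih _ (by omega) _ rfl s hs) ht
  have := key _ ξ rfl t ht
  rwa [hf, integral_indicator_const _ (MeasurableSet.singleton _), smul_eq_mul, mul_one,
    Real.toNNReal_coe] at this

theorem invariant_unique (hJ : 0 < J) (hP : IsInterfaceSemigroup J P)
    {μ ν : ProbabilityMeasure Interface} (hμ : IsInvariantLaw P μ) (hν : IsInvariantLaw P ν) :
    μ = ν := by
  have := hP.markov 1
  have h : (μ : Measure Interface) = ν :=
    FreeBoundary.invariant_unique (hP.pos_coneO hJ one_pos) (hμ 1) (hν 1)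
  exact Subtype.ext h

/-! ### Tightness and convergence of the process started from the cone. -/

/-- The truncated size of the support. -/
noncomputable def _root_.FreeBoundary.Interface.truncCard (m : ℕ) (ξ : Interface) : ℝ :=
  min (ξ.supp.card : ℝ) m

theorem _root_.FreeBoundary.Interface.truncCard_nonneg (m : ℕ) (ξ : Interface) :
    0 ≤ ξ.truncCard m := le_min (Nat.cast_nonneg _) (Nat.cast_nonneg _)

theorem _root_.FreeBoundary.Interface.bdd_truncCard (m : ℕ) : Bdd (truncCard m) :=
  Bdd.of_nonneg_of_le (truncCard_nonneg m) fun _ => min_le_right _ _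

theorem _root_.FreeBoundary.Interface.truncCard_mono (m : ℕ) : Monotone (truncCard m) :=
  fun _ _ h => min_le_min_right _ (Nat.cast_le.2 (Finset.card_le_card (supp_mono h)))

/-- The drift inequality bounds only a time average. Monotonicity in time converts it: integrating
up to `2 * t`, the second half of the interval contributes at least `t` times the value at `t`.
Truncation keeps the function bounded, and the bound does not depend on `m`. -/
theorem integral_truncCard_le (hJ : 0 < J) (hP : IsInterfaceSemigroup J P) (m : ℕ) (t : ℝ≥0) :
    ∫ η, η.truncCard m ∂(P t coneO) ≤ 1 / J := by
  have hL := isLyapunov_area hJ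
  have hb := bdd_truncCard m
  have hmono := hP.integral_coneO_mono hJ (truncCard_mono m) hb
  suffices h : ∀ t : ℝ≥0, 0 < t → ∫ η, η.truncCard m ∂(P t coneO) ≤ 1 / J from
    (hmono (le_add_of_nonneg_right zero_le_one : t ≤ t + 1)).trans (h _ (by positivity))
  intro t ht
  have hu := hP.isSolution hb
  have hcont : ∀ ξ, Continuous fun s : ℝ => ∫ η, η.truncCard m ∂(P s.toNNReal ξ) := by
    intro ξ
    have := (hu.continuousOn ξ).comp_continuous (f := fun s : ℝ => max s 0) (by fun_prop)
      fun s => le_max_right s 0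
    refine this.congr fun s => ?_
    simp only [Function.comp_apply, Real.toNNReal, max_eq_left (le_max_right s 0)]
  obtain ⟨C, hC⟩ := (hb.smul (2 * J))
  have hsc := hu.smul hL (2 * J)
  have h1 := hsc.integral_le hL (fun ξ => continuous_const.mul (hcont ξ)) hC (fun ξ => ?_)
    (t := 2 * (t : ℝ)) (by positivity) coneO
  · have h0 : coneO.area = 0 := Finset.sum_eq_zero fun x hx => by
      simp [coneO, cone_zero]
    have h2 : ∀ a b, IntervalIntegrable
        (fun s : ℝ => ∫ η, η.truncCard m ∂(P s.toNNReal coneO)) volume a b :=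
      fun a b => (hcont coneO).intervalIntegrable a b
    simp only [Pi.smul_apply, smul_eq_mul, h0, Int.cast_zero, zero_add, one_mul] at h1
    rw [intervalIntegral.integral_const_mul,
      ← intervalIntegral.integral_add_adjacent_intervals (h2 0 t) (h2 t (2 * t))] at h1
    have h3 : 0 ≤ ∫ s in (0 : ℝ)..t, ∫ η, η.truncCard m ∂(P s.toNNReal coneO) :=
      intervalIntegral.integral_nonneg t.coe_nonneg fun s _ =>
        integral_nonneg fun η => truncCard_nonneg m η
    have h4 : t * ∫ η, η.truncCard m ∂(P t coneO) ≤
        ∫ s in (t : ℝ)..(2 * t), ∫ η, η.truncCard m ∂(P s.toNNReal coneO) := by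
      have := intervalIntegral.integral_mono_on (a := (t : ℝ)) (b := 2 * t)
        (f := fun _ => ∫ η, η.truncCard m ∂(P t coneO)) (by linarith [t.coe_nonneg])
        intervalIntegrable_const (h2 t (2 * t)) fun s hs => hmono (NNReal.le_toNNReal_of_coe_le hs.1)
      rwa [intervalIntegral.integral_const, smul_eq_mul,
        show 2 * (t : ℝ) - t = t by ring] at this
    have ht' : (0 : ℝ) < t := ht
    rw [le_div_iff₀ hJ]
    have h5 : t * (∫ η, η.truncCard m ∂(P t coneO)) * J ≤ t * 1 := by nlinarith
    rw [mul_assoc] at h5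
    exact le_of_mul_le_mul_left h5 ht'
  · have h2 := jumpGen_area_le hJ ξ
    have h3 : ξ.truncCard m ≤ ξ.supp.card := min_le_left _ _
    have h4 : 2 * J * ξ.truncCard m ≤ 2 * J * ξ.supp.card := by gcongr
    simp only [Pi.smul_apply, smul_eq_mul]
    linarith

theorem integral_large_le (hJ : 0 < J) (hP : IsInterfaceSemigroup J P) {m : ℕ} (hm : 0 < m)
    (t : ℝ≥0) :
    ∫ η, ({ξ : Interface | ξ.supp.card ≤ m}ᶜ.indicator (fun _ => (1 : ℝ)) η) ∂(P t coneO) ≤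
      1 / J / m := by
  have := hP.markov t
  have hm' : (0 : ℝ) < m := by exact_mod_cast hm
  rw [le_div_iff₀ hm', ← integral_mul_const]
  refine le_trans (integral_mono (((bdd_indicator _).mul (bdd_const (m : ℝ))).integrable _)
    ((bdd_truncCard m).integrable _) fun ξ => ?_) (hP.integral_truncCard_le hJ m t)
  by_cases hξ : ξ.supp.card ≤ m
  · simpa [hξ] using truncCard_nonneg m ξ
  · have : (m : ℝ) ≤ ξ.supp.card := by exact_mod_cast (not_le.1 hξ).le
    simp [hξ, truncCard, this]

/-- Along an ultrafilter the integrals of all bounded functions converge at once, with no extraction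
of subsequences; the uniform support bound makes the limit functional a measure. -/
theorem exists_ultrafilter_limit (hJ : 0 < J) (hP : IsInterfaceSemigroup J P)
    (U : Ultrafilter ℝ≥0) :
    ∃ π : Measure Interface, IsProbabilityMeasure π ∧ ∀ f, Bdd f →
      Tendsto (fun t => ∫ η, f η ∂(P t coneO)) U (𝓝 (∫ η, f η ∂π)) := by
  have := hP.markov
  have hex : ∀ f : Interface → ℝ, ∃ l, Bdd f →
      Tendsto (fun t => ∫ η, f η ∂(P t coneO)) U (𝓝 l) := by
    intro f
    by_cases hf : Bdd f
    · obtain ⟨C, hC⟩ := hf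
      obtain ⟨l, -, hl⟩ := isCompact_Icc.ultrafilter_le_nhds
        (U.map fun t => ∫ η, f η ∂(P t coneO)) (s := Set.Icc (-C) C) (by
          refine le_principal_iff.2 (Filter.mem_map.2 (univ_mem' fun t => ?_))
          refine abs_le.1 ?_
          simpa using norm_integral_le_of_norm_le_const (μ := P t coneO)
            (Eventually.of_forall fun η => (Real.norm_eq_abs (f η)).trans_le (hC η)))
      exact ⟨l, fun _ => hl⟩
    · exact ⟨0, fun h => absurd h hf⟩
  choose Λ hΛ using hex
  suffices h : ∃ π : Measure Interface, IsProbabilityMeasure π ∧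
      ∀ f, Bdd f → ∫ η, f η ∂π = Λ f by
    obtain ⟨π, hπ1, hπ⟩ := h
    exact ⟨π, hπ1, fun f hf => by rw [hπ f hf]; exact hΛ f hf⟩
  refine exists_measure_of_tight Λ ?_ ?_ ?_ ?_ ?_
  · intro f g hf hg
    refine tendsto_nhds_unique (hΛ _ (hf.add hg)) (((hΛ f hf).add (hΛ g hg)).congr fun t => ?_)
    exact (MeasureTheory.integral_add (hf.integrable _) (hg.integrable _)).symm
  · intro a f hf
    refine tendsto_nhds_unique (hΛ _ (hf.smul a)) (((hΛ f hf).const_mul a).congr fun t => ?_)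
    exact (integral_const_mul a _).symm
  · exact fun f hf h0 => ge_of_tendsto' (hΛ f hf) fun t => integral_nonneg h0
  · refine tendsto_nhds_unique (hΛ _ (bdd_const 1)) ?_
    simp
  · intro ε hε
    obtain ⟨m, hm⟩ := exists_nat_gt (1 / J / ε)
    have hm0 : (0 : ℝ) < m := lt_of_le_of_lt (by positivity) hm
    refine ⟨(finite_card_supp_le m).toFinset, ?_⟩
    rw [Set.Finite.coe_toFinset]
    refine le_of_tendsto' (hΛ _ (bdd_indicator _)) fun t =>
      (hP.integral_large_le hJ (by exact_mod_cast hm0) t).trans ?_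
    rw [div_le_iff₀ hm0, mul_comm, ← div_le_iff₀ hε]
    exact hm.le

/-- Probabilities of upper sets increase in time, and a point is the difference of the upper sets
`Set.Ici ξ` and `Set.Ioi ξ`. -/
theorem exists_limit_singleton (hJ : 0 < J) (hP : IsInterfaceSemigroup J P) (ξ : Interface) :
    ∃ l, Tendsto (fun t => ∫ η, ({ξ} : Set Interface).indicator (fun _ => (1 : ℝ)) η
      ∂(P t coneO)) atTop (𝓝 l) := by
  have := hP.markov
  have hup : ∀ A : Set Interface, IsUpperSet A → ∃ l, Tendsto (fun t =>
      ∫ η, A.indicator (fun _ => (1 : ℝ)) η ∂(P t coneO)) atTop (𝓝 l) := by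
    intro A hA
    have hm : Monotone (A.indicator fun _ => (1 : ℝ)) := by
      intro η ζ h
      by_cases hη : η ∈ A
      · simp [hη, hA h hη]
      · rw [Set.indicator_of_notMem hη]
        exact Set.indicator_nonneg (fun _ _ => zero_le_one) ζ
    refine ⟨_, tendsto_atTop_ciSup (hP.integral_coneO_mono hJ hm (bdd_indicator A)) ⟨1, ?_⟩⟩
    rintro _ ⟨t, rfl⟩
    simp only
    rw [integral_indicator_const _ MeasurableSet.of_discrete, smul_eq_mul, mul_one]
    exact measureReal_le_one
  obtain ⟨l₁, h₁⟩ := hup (Set.Ici ξ) (isUpperSet_Ici ξ)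
  obtain ⟨l₂, h₂⟩ := hup (Set.Ioi ξ) (isUpperSet_Ioi ξ)
  refine ⟨l₁ - l₂, (h₁.sub h₂).congr fun t => ?_⟩
  rw [← integral_sub ((bdd_indicator _).integrable _) ((bdd_indicator _).integrable _)]
  refine integral_congr_ae (Eventually.of_forall fun η => ?_)
  simp only [Set.indicator, Set.mem_Ici, Set.mem_Ioi, Set.mem_singleton_iff]
  rcases eq_or_ne η ξ with rfl | h
  · simp
  · by_cases h' : ξ ≤ η
    · simp [h, h', lt_of_le_of_ne h' h.symm]
    · simp [h, h', mt le_of_lt h']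

/-- The law of the process started from the cone converges. -/
theorem exists_limit (hJ : 0 < J) (hP : IsInterfaceSemigroup J P) :
    ∃ π : ProbabilityMeasure Interface, ∀ f, Bdd f →
      Tendsto (fun t => ∫ η, f η ∂(P t coneO)) atTop (𝓝 (∫ η, f η ∂(π : Measure Interface))) := by
  have hlim : ∀ U : Ultrafilter ℝ≥0, ↑U ≤ (atTop : Filter ℝ≥0) → ∀ π : Measure Interface,
      IsProbabilityMeasure π → (∀ f, Bdd f →
        Tendsto (fun t => ∫ η, f η ∂(P t coneO)) U (𝓝 (∫ η, f η ∂π))) →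
      ∀ ξ, π.real {ξ} = (hP.exists_limit_singleton hJ ξ).choose := by
    intro U hU π _ hπ ξ
    have h1 := hπ _ (bdd_indicator {ξ})
    have h2 := (hP.exists_limit_singleton hJ ξ).choose_spec.mono_left hU
    rw [integral_indicator_const _ (MeasurableSet.singleton ξ), smul_eq_mul, mul_one] at h1
    exact tendsto_nhds_unique h1 h2
  obtain ⟨π, hπ1, hπ⟩ := hP.exists_ultrafilter_limit hJ (Ultrafilter.of atTop)
  refine ⟨⟨π, hπ1⟩, fun f hf => (tendsto_iff_ultrafilter _ _ _).2 fun U hU => ?_⟩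
  obtain ⟨ρ, hρ1, hρ⟩ := hP.exists_ultrafilter_limit hJ U
  -- All ultrafilter limits have the same point masses, so they agree, which is convergence along
  -- `atTop`.
  have : ρ = π := Measure.ext_of_singleton fun ξ => by
    have h1 := hlim U hU ρ hρ1 hρ ξ
    have h2 := hlim _ (Ultrafilter.of_le atTop) π hπ1 hπ ξ
    exact (measureReal_eq_measureReal_iff).1 (h1.trans h2.symm)
  exact this ▸ hρ f hf

/-- Both `P_t (P_s f)` and `P_(t+s) f`, evaluated at the cone, are the same number; the two readings
of its limit express invariance. -/
theorem isInvariantLaw_of_tendsto (hP : IsInterfaceSemigroup J P)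
    {π : ProbabilityMeasure Interface} (hπ : ∀ f, Bdd f →
      Tendsto (fun t => ∫ η, f η ∂(P t coneO)) atTop
        (𝓝 (∫ η, f η ∂(π : Measure Interface)))) : IsInvariantLaw P π := by
  intro s
  have := hP.markov s
  refine measure_ext_of_forall_integral fun f hf => ?_
  rw [hf.integral_bind]
  refine tendsto_nhds_unique (hπ _ (hf.kernel_integral (P s))) ?_
  refine ((hπ f hf).comp (tendsto_atTop_mono (fun t => le_self_add (b := s)) tendsto_id)).congr fun t => ?_
  exact hP.integral_add hf t s coneO

theorem tendsto_of_isInvariantLaw (hJ : 0 < J) (hP : IsInterfaceSemigroup J P)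
    {μ : ProbabilityMeasure Interface} (hμ : IsInvariantLaw P μ) {f : Interface → ℝ}
    (hf : Bdd f) :
    Tendsto (fun t => ∫ η, f η ∂(P t coneO)) atTop (𝓝 (∫ η, f η ∂(μ : Measure Interface))) := by
  obtain ⟨π, hπ⟩ := hP.exists_limit hJ
  rw [hP.invariant_unique hJ hμ (hP.isInvariantLaw_of_tendsto hπ)]
  exact hπ f hf

/-- Both processes are started from the cone, compared at each time through the rates of the
decreasing kill moves, and sent to their limits. -/
theorem stochLE_of_rate_le {J' : ℝ} {P' : ℝ≥0 → Kernel Interface Interface} (hJ' : 0 < J')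
    (hJJ' : J' ≤ J) (hP : IsInterfaceSemigroup J P) (hP' : IsInterfaceSemigroup J' P')
    {μ μ' : ProbabilityMeasure Interface} (hμ : IsInvariantLaw P μ)
    (hμ' : IsInvariantLaw P' μ') : StochLE μ μ' := by
  have hJ := hJ'.trans_le hJJ'
  refine stochLE_of_bdd fun f hm hf => ?_
  refine le_of_tendsto_of_tendsto' (hP.tendsto_of_isInvariantLaw hJ hμ hf)
    (hP'.tendsto_of_isInvariantLaw hJ' hμ' hf) fun t => ?_
  have hr : ∀ i, rates J i = rates J' i ∨ rates J' i ≤ rates J i ∧ ∀ ξ, moves i ξ ≤ ξ := by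
    rintro (x | x | (_ | _))
    · exact Or.inl rfl
    · exact Or.inl rfl
    · exact Or.inr ⟨hJJ', kill_le (-1) (by norm_num)⟩
    · exact Or.inr ⟨hJJ', kill_le 1 (by norm_num)⟩
  simpa using (hP.isSolution hf).le_of_rates_le (isLyapunov_area hJ) (isLyapunov_area hJ')
    moves_mono hr hm (hP'.isSolution hf) t.coe_nonneg coneO

end IsInterfaceSemigroup

theorem exists_isInterfaceSemigroup {J : ℝ} (hJ : 0 < J) :
    ∃ P : ℝ≥0 → Kernel Interface Interface, IsInterfaceSemigroup J P := by
  obtain ⟨P, hM, h0, hadd, hsol⟩ := (isLyapunov_area hJ).exists_semigroup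
  refine ⟨P, hM, h0, hadd, fun f hf ξ t => ?_⟩
  rw [generator_eq_jumpGen]
  simpa using (hsol f hf).deriv t t.coe_nonneg ξ

end FreeBoundary

theorem corollaryt13 :
    -- the process is well defined, and has exactly one invariant probability measure
    (∀ J : ℝ, 0 < J → ∃! P : ℝ≥0 → Kernel Interface Interface, IsInterfaceSemigroup J P) ∧
    (∀ J : ℝ, 0 < J → ∀ P : ℝ≥0 → Kernel Interface Interface, IsInterfaceSemigroup J P →
      ∃! μ : ProbabilityMeasure Interface, IsInvariantLaw P μ) ∧
    -- attractivity; monotonicity, domination and convergence for the process started from the cone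
    (∀ J : ℝ, 0 < J → ∀ (P : ℝ≥0 → Kernel Interface Interface) (hP : IsInterfaceSemigroup J P)
      (μ : ProbabilityMeasure Interface), IsInvariantLaw P μ →
      Attractive hP ∧
      (∀ s t : ℝ≥0, s ≤ t → StochLE (lawAt hP startCone s) (lawAt hP startCone t)) ∧
      (∀ t : ℝ≥0, StochLE (lawAt hP startCone t) μ) ∧
      Tendsto (fun t : ℝ≥0 => lawAt hP startCone t) atTop (𝓝 μ)) ∧
    -- the invariant measures are stochastically ordered
    (∀ J J' : ℝ, 0 < J' → J' ≤ J →
      ∀ P P' : ℝ≥0 → Kernel Interface Interface,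
      IsInterfaceSemigroup J P → IsInterfaceSemigroup J' P' →
      ∀ μ μ' : ProbabilityMeasure Interface, IsInvariantLaw P μ → IsInvariantLaw P' μ' →
      StochLE μ μ') := by
  refine ⟨fun J hJ => ?_, fun J hJ P hP => ?_, fun J hJ P hP μ hμ => ⟨hP.attractive hJ,
    fun s t hst => hP.stochLE_lawAt_startCone hJ hst, hP.stochLE_invariant hJ hμ, ?_⟩,
    fun J J' hJ' hJJ' P P' hP hP' μ μ' hμ hμ' => hP.stochLE_of_rate_le hJ' hJJ' hP' hμ hμ'⟩
  · obtain ⟨P, hP⟩ := exists_isInterfaceSemigroup hJ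
    exact ⟨P, hP, fun Q hQ => hQ.eq hJ hP⟩
  · obtain ⟨π, hπ⟩ := hP.exists_limit hJ
    exact ⟨π, hP.isInvariantLaw_of_tendsto hπ, fun μ hμ =>
      hP.invariant_unique hJ hμ (hP.isInvariantLaw_of_tendsto hπ)⟩
  · rw [ProbabilityMeasure.tendsto_iff_forall_integral_tendsto]
    intro f
    have hf : Bdd f := ⟨‖f‖, f.norm_coe_le_norm⟩
    simp only [hP.integral_lawAt_startCone hf]
    exact hP.tendsto_of_isInvariantLaw hJ hμ hf
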